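/- Let $d\ge 1$ be an integer, $p\ge 1$ and $r\in(1,2)$ real numbers. For $y\in\mathbb R^d$ let $|y|=\max_i|y_i|$, and let $|\cdot|_2$ be the Euclidean norm. For a probability measure $\mu$ on $\mathbb R^d$ and a random variable $X$ with distribution $\mu$, put $$\|X\|_{rp,w}=\Big(\sup_{t>0}t^{rp}\,\mathbb P(|X|>t)\Big)^{1/(rp)},$$ and for probability measures $\nu_1,\nu_2$ on $\mathbb R^d$ put $$W_p^p(\nu_1,\nu_2)=\inf_{\pi\in\Pi(\nu_1,\nu_2)}\int|x-y|_2^p\,\pi(dx,dy),$$ where $\Pi(\nu_1,\nu_2)$ is the set of probability measures on $\mathbb R^d\times\mathbb R^d$ with margins $\nu_1,\nu_2$. Let $\log_+u=\max\{0,\log u\}$. **Theorem.** There is a constant $C>0$, depending only on $d,p,r$, such that the following holds for every probability measure $\mu$ on $\mathbb R^d$ with $\|X\|_{rp,w}<\infty$, every integer $n\ge1$ (with $n\ge 2$ if $p=d(r-1)/r$), every real $x>0$, and all independent random variables $X_1,\dots,X_n$ with common distribution $\mu$, with $\mu_k=\frac1k\sum_{i=1}^k\delta_{X_i}$ for $1\le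 k\le n$. Both probabilities $$\mathbb P\big(W_p^p(\mu_n,\mu)>x\big)\qquad\text{and}\qquad \mathbb P\Big(\max_{1\le k\le n}k\,W_p^p(\mu_k,\mu)>nx\Big)$$ are at most $$C\cdot\begin{cases}\dfrac{\|X\|_{rp,w}^{rp}}{x^r n^{r-1}} & \text{if } p>d(r-1)/r,\\[2mm] \dfrac{\|X\|_{rp,w}^{rp}(\log n)^r}{x^r n^{r-1}}\left(1+\log_+\!\left(\dfrac{x^{1/p}\,n^{r/(dr-d)}}{\|X\|_{rp,w}}\right)\right)^{r} & \text{if } p=d(r-1)/r,\\[2mm] \dfrac{\|X\|_{rp,w}^{rp}}{x^r n^{rp/d}} & \text{if } 1\le p<d(r-1)/r.\end{cases}$$ (If $\|X\|_{rp,w}=0$, the bound in the second case is read as $0$.) -/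

import Mathlib

open MeasureTheory ProbabilityTheory
open scoped ENNReal

noncomputable section

/-- The tail `H(t) = μ {y : |y| > t}` of a measure on `ℝ^d`, where `|y| = max_i |y_i|`
(the sup norm of the coordinate vector `y.ofLp : Fin d → ℝ`). -/
def tail {d : ℕ} (μ : Measure (EuclideanSpace ℝ (Fin d))) (t : ℝ) : ℝ≥0∞ :=
  μ {y | t < ‖y.ofLp‖}

/-- The weak moment `‖X‖_{q,w} = (sup_{t > 0} t^q H(t))^{1/q}` of a random variable `X` with
distribution `μ`, as an extended nonnegative real. -/
def weakMoment {d : ℕ} (q : ℝ) (μ : Measure (EuclideanSpace ℝ (Fin d))) : ℝ≥0∞ :=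
  (⨆ (t : ℝ) (_ : 0 < t), ENNReal.ofReal (t ^ q) * tail μ t) ^ (1 / q)

/-- The probability measures on `ℝ^d × ℝ^d` with margins `ν₁` and `ν₂`. -/
def couplings {d : ℕ} (ν₁ ν₂ : Measure (EuclideanSpace ℝ (Fin d))) :
    Set (Measure (EuclideanSpace ℝ (Fin d) × EuclideanSpace ℝ (Fin d))) :=
  {π | IsProbabilityMeasure π ∧ π.map Prod.fst = ν₁ ∧ π.map Prod.snd = ν₂}

/-- `W_p^p(ν₁, ν₂)`: the infimum over the couplings of `∫ |x - y|_2^p`, with the Euclidean norm,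
as an extended nonnegative real. -/
def wassersteinPow {d : ℕ} (p : ℝ) (ν₁ ν₂ : Measure (EuclideanSpace ℝ (Fin d))) : ℝ≥0∞ :=
  ⨅ π ∈ couplings ν₁ ν₂, ∫⁻ z, ENNReal.ofReal (‖z.1 - z.2‖ ^ p) ∂π

/-- The empirical distribution `(1/k) ∑ δ_{y_i}` of the points `y_1, …, y_k`. -/
def empirical {d k : ℕ} (y : Fin k → EuclideanSpace ℝ (Fin d)) :
    Measure (EuclideanSpace ℝ (Fin d)) :=
  (k : ℝ≥0∞)⁻¹ • ∑ i, Measure.dirac (y i)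

/-- The right-hand side of the deviation inequality, up to the multiplicative constant;
`N` stands for `‖X‖_{rp,w}`, and `Real.posLog u = max 0 (log u)`. -/
def deviationRate (d : ℕ) (p r N : ℝ) (n : ℕ) (x : ℝ) : ℝ :=
  if p > d * (r - 1) / r then
    N ^ (r * p) / (x ^ r * (n : ℝ) ^ (r - 1))
  else if p = d * (r - 1) / r then
    N ^ (r * p) * (Real.log n) ^ r / (x ^ r * (n : ℝ) ^ (r - 1)) *
      (1 + Real.posLog (x ^ (1 / p) * (n : ℝ) ^ (r / (d * r - d)) / N)) ^ r
  else
    N ^ (r * p) / (x ^ r * (n : ℝ) ^ (r * p / d))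

end

/-! Put s = N, the weak moment, and q = rp. Cut ℝ^d into the ball |y| ≤ s and the dyadic shells of
radii s 2^m, and each shell into nested cubes of relative side 2^(-l). Matching as much mass as
possible in the finest cubes and passing the rest on to coarser ones bounds W_p^p(α, β) by a
constant times ∑_l 2^(-pl) ∑_m (s 2^m)^p ∑ |α - β|(cell) (`wassersteinPow_le_multiscaleSum`). For α
= μ_k, the quantity k |μ_k(A) - μ(A)| is at most the maximum over k ≤ n of the centred partial sums
of 1_A(X_i). Hence a single random multiscale sum controls all k at once, and the bound for μ_n is
the case k = n of the maximal one.

Doob's L² inequality bounds the second moment of one such maximum by 4 n μ(A). Let a² bound n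
μ(shell m); it may be taken of order n 2^(-qm). Cauchy–Schwarz over about 2^(dl) cubes, or else the
plain number of points in the shell, bounds the L² norm of the deviation in shell m at level l by a
constant times a min(2^(dl/2), 1 + a). Summing over l with weights 2^(-pl) gives a (1 + a)^θ, for
any θ in [0, 1] with (d/2)(1 - θ) < p, and also for θ = 1 - 2p/d when p < d/2.

Since r < 2, second moments are available only after truncation, at the shell M with 2^(pM) ≈ v = n
x / N^p (`exists_isDeviationBound`). Some sample point lies beyond shell M with probability of order
at most n v^(-r). Otherwise the outer shells contribute only their expected mass, at most half of
the allowed cost unless n v^(-r) is bounded below, when the claim is trivial. With τ = (1 + θ)/2,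
Chebyshev on the inner shells gives the square of (n^(1/2) ∑ 2^((p-q/2)m) + n^τ ∑ 2^((p-qτ)m)) / v,
with sums over m ≤ M. As r < 2, the first sum is governed by its last term and yields n v^(-r).

The second sum depends on the sign of 1 - rτ. If p > d(r-1)/r, some admissible θ has rτ < 1, and n
v^(-r) results again. Otherwise θ = 1 - 2p/d and τ = 1 - p/d: at equality rτ = 1 and the sum is M +
1, a logarithm; below, the sum is bounded. In these two cases min(1, y²) ≤ y^r turns the square into
the decay v^(-r). -/

set_option linter.unusedSectionVars false

/-! ### Greedy matching of two measures inside the cells of a partition -/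

section Matching

variable {E ι : Type*} [MeasurableSpace E] [MeasurableSpace ι] [Countable ι]
  [MeasurableSingletonClass ι]

/-- The part of `α.prod β` that lives on the pairs with the same label under `f`, with a density
that depends on the label only. -/
noncomputable def labelCoupling (f : E → ι) (h : ι → ℝ≥0∞) (α β : Measure E) : Measure (E × E) :=
  (α.prod β).withDensity ({z : E × E | f z.1 = f z.2}.indicator fun z => h (f z.1))

lemma measurableSet_same_label {f : E → ι} (hf : Measurable f) :
    MeasurableSet {z : E × E | f z.1 = f z.2} :=
  measurableSet_eq_fun (hf.comp measurable_fst) (hf.comp measurable_snd)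

lemma measurable_labelDensity {f : E → ι} (hf : Measurable f) (h : ι → ℝ≥0∞) :
    Measurable ({z : E × E | f z.1 = f z.2}.indicator fun z => h (f z.1)) :=
  (((measurable_of_countable h).comp hf).comp measurable_fst).indicator
    (measurableSet_same_label hf)

lemma labelCoupling_map_fst {f : E → ι} (hf : Measurable f) (h : ι → ℝ≥0∞) (α β : Measure E)
    [SFinite α] [SFinite β] :
    (labelCoupling f h α β).map Prod.fst
      = α.withDensity fun x => h (f x) * β (f ⁻¹' {f x}) := by
  ext s hs
  rw [Measure.map_apply measurable_fst hs, labelCoupling, withDensity_apply _ (measurable_fst hs),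
    withDensity_apply _ hs, ← lintegral_indicator (measurable_fst hs),
    lintegral_prod _ ((measurable_labelDensity hf h).indicator (measurable_fst hs)).aemeasurable,
    ← lintegral_indicator hs]
  refine lintegral_congr fun x => ?_
  by_cases hx : x ∈ s
  · have : ∀ y, (Prod.fst ⁻¹' s).indicator
        ({z : E × E | f z.1 = f z.2}.indicator fun z => h (f z.1)) (x, y)
        = (f ⁻¹' {f x}).indicator (fun _ => h (f x)) y := by
      intro y
      by_cases hy : f x = f y
      · simp [Set.indicator, hx, hy]
      · simp [Set.indicator, hx, hy, Ne.symm hy]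
    simp_rw [this]
    rw [lintegral_indicator (hf (measurableSet_singleton _))]
    simp [hx]
  · simp [hx]

lemma labelCoupling_map_snd {f : E → ι} (hf : Measurable f) (h : ι → ℝ≥0∞) (α β : Measure E)
    [SFinite α] [SFinite β] :
    (labelCoupling f h α β).map Prod.snd
      = β.withDensity fun x => h (f x) * α (f ⁻¹' {f x}) := by
  ext s hs
  rw [Measure.map_apply measurable_snd hs, labelCoupling, withDensity_apply _ (measurable_snd hs),
    withDensity_apply _ hs, ← lintegral_indicator (measurable_snd hs),
    lintegral_prod_symm _
      ((measurable_labelDensity hf h).indicator (measurable_snd hs)).aemeasurable,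
    ← lintegral_indicator hs]
  refine lintegral_congr fun y => ?_
  by_cases hy : y ∈ s
  · have : ∀ x, (Prod.snd ⁻¹' s).indicator
        ({z : E × E | f z.1 = f z.2}.indicator fun z => h (f z.1)) (x, y)
        = (f ⁻¹' {f y}).indicator (fun _ => h (f y)) x := by
      intro x
      by_cases hx : f x = f y
      · simp [Set.indicator, hx, hy]
      · simp [Set.indicator, hx, hy]
    simp_rw [this]
    rw [lintegral_indicator (hf (measurableSet_singleton _))]
    simp [hy]
  · simp [hy]

lemma labelCoupling_compl (f : E → ι) (hf : Measurable f) (h : ι → ℝ≥0∞) (α β : Measure E) :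
    labelCoupling f h α β {z | f z.1 ≠ f z.2} = 0 := by
  have hm : MeasurableSet {z : E × E | f z.1 ≠ f z.2} := (measurableSet_same_label hf).compl
  rw [labelCoupling, withDensity_apply _ hm, ← lintegral_indicator hm]
  refine (lintegral_congr fun z => ?_).trans lintegral_zero
  by_cases hz : f z.1 = f z.2 <;> simp [hz]

/-- The weight that matches as much mass as possible between sets of masses `a` and `b`. -/
noncomputable def matchWeight (a b : ℝ≥0∞) : ℝ≥0∞ := min a b / (a * b)

lemma matchWeight_comm (a b : ℝ≥0∞) : matchWeight a b = matchWeight b a := by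
  rw [matchWeight, matchWeight, min_comm, mul_comm]

lemma matchWeight_mul_mul {a b : ℝ≥0∞} (ha : a ≠ ∞) (hb : b ≠ ∞) :
    matchWeight a b * b * a = min a b := by
  rcases eq_or_ne a 0 with rfl | ha0
  · simp
  rcases eq_or_ne b 0 with rfl | hb0
  · simp
  rw [matchWeight, mul_assoc, mul_comm b a,
    ENNReal.div_mul_cancel (mul_ne_zero ha0 hb0) (ENNReal.mul_ne_top ha hb)]

/-- This is what keeps the matched part below the measure it is taken from, so that a nonnegative
remainder exists. -/
lemma matchWeight_mul_le_one {a b : ℝ≥0∞} (ha : a ≠ ∞) (hb : b ≠ ∞) :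
    matchWeight a b * b ≤ 1 := by
  rcases eq_or_ne a 0 with rfl | ha0
  · simp [matchWeight]
  rw [← ENNReal.mul_le_mul_iff_left ha0 ha, matchWeight_mul_mul ha hb, one_mul]
  exact min_le_left _ _

/-- In a cell of masses a and b the matched fraction of α is κ = min(a, b) / a ≤ 1. The remainder
has density 1 - κ, and its mass a - min(a, b) is the truncated difference. -/
lemma exists_remainder {f : E → ι} (hf : Measurable f) (α β : Measure E) [IsFiniteMeasure α]
    [IsFiniteMeasure β] :
    ∃ α' : Measure E,
      α = α.withDensity (fun x => matchWeight (α (f ⁻¹' {f x})) (β (f ⁻¹' {f x}))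
        * β (f ⁻¹' {f x})) + α' ∧
      ∀ i, α' (f ⁻¹' {i}) = α (f ⁻¹' {i}) - β (f ⁻¹' {i}) := by
  set κ : ι → ℝ≥0∞ := fun i => matchWeight (α (f ⁻¹' {i})) (β (f ⁻¹' {i})) * β (f ⁻¹' {i})
    with hκ
  have hκ1 : ∀ i, κ i ≤ 1 := fun i => matchWeight_mul_le_one (by simp) (by simp)
  have hκm : Measurable fun x => κ (f x) := (measurable_of_countable κ).comp hf
  refine ⟨α.withDensity fun x => 1 - κ (f x), ?_, fun i => ?_⟩
  · change α = α.withDensity (fun x => κ (f x)) + _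
    rw [← withDensity_add_left hκm]
    have : (fun x => κ (f x)) + (fun x => 1 - κ (f x)) = 1 := by
      ext x
      simp [add_tsub_cancel_of_le (hκ1 (f x))]
    rw [this, withDensity_one]
  · have hm : MeasurableSet (f ⁻¹' {i}) := hf (measurableSet_singleton _)
    rw [withDensity_apply _ hm, setLIntegral_congr_fun (g := fun _ => 1 - κ i) hm
      (fun x hx => by simp only [Set.mem_preimage, Set.mem_singleton_iff] at hx; simp [hx])]
    rw [setLIntegral_const, ENNReal.sub_mul (by simp), one_mul, hκ]
    simp only
    rw [matchWeight_mul_mul (by simp) (by simp), ← tsub_eq_tsub_min]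

/-- Matching as much mass as possible between two finite measures inside the cells of a countable
partition. -/
lemma exists_partial_coupling {f : E → ι} (hf : Measurable f) (α β : Measure E)
    [IsFiniteMeasure α] [IsFiniteMeasure β] :
    ∃ (π : Measure (E × E)) (α' β' : Measure E),
      α = π.map Prod.fst + α' ∧ β = π.map Prod.snd + β' ∧ π {z | f z.1 ≠ f z.2} = 0 ∧
      (∀ i, α' (f ⁻¹' {i}) = α (f ⁻¹' {i}) - β (f ⁻¹' {i})) ∧
      (∀ i, β' (f ⁻¹' {i}) = β (f ⁻¹' {i}) - α (f ⁻¹' {i})) := by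
  obtain ⟨α', hα, hα'⟩ := exists_remainder hf α β
  obtain ⟨β', hβ, hβ'⟩ := exists_remainder hf β α
  refine ⟨labelCoupling f (fun i => matchWeight (α (f ⁻¹' {i})) (β (f ⁻¹' {i}))) α β, α', β',
    ?_, ?_, labelCoupling_compl f hf _ α β, hα', hβ'⟩
  · rw [labelCoupling_map_fst hf]
    exact hα
  · rw [labelCoupling_map_snd hf]
    simp_rw [matchWeight_comm (α _)]
    exact hβ

end Matching

/-! ### Coupling along nested partitions -/

section Multiscale

variable {E ι : Type*} [MeasurableSpace E] [MeasurableSpace ι] [Countable ι]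
  [MeasurableSingletonClass ι]

/-- The weighted excess of `α` over `β` on the cells of `f`. -/
noncomputable def cellExcess (f : E → ι) (w : ι → ℝ≥0∞) (α β : Measure E) : ℝ≥0∞ :=
  ∑' i, w i * (α (f ⁻¹' {i}) - β (f ⁻¹' {i}))

lemma lintegral_label {f : E → ι} (hf : Measurable f) (w : ι → ℝ≥0∞) (α : Measure E) :
    ∫⁻ x, w (f x) ∂α = ∑' i, w i * α (f ⁻¹' {i}) := by
  rw [← lintegral_map (measurable_of_countable w) hf, lintegral_countable']
  simp_rw [Measure.map_apply hf (measurableSet_singleton _)]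

lemma apply_fst_eq_apply_snd {f g : E → ι} (hg : Measurable g)
    (hfg : ∀ x y, f x = f y → g x = g y) {π : Measure (E × E)} (hπ : π {z | f z.1 ≠ f z.2} = 0)
    (i : ι) : π.map Prod.fst (g ⁻¹' {i}) = π.map Prod.snd (g ⁻¹' {i}) := by
  rw [Measure.map_apply measurable_fst (hg (measurableSet_singleton _)),
    Measure.map_apply measurable_snd (hg (measurableSet_singleton _))]
  refine measure_congr ?_
  have : ∀ᵐ z ∂π, f z.1 = f z.2 := by
    rw [ae_iff]; exact hπ
  filter_upwards [this] with z hz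
  have := hfg _ _ hz
  refine propext ?_
  change g z.1 = i ↔ g z.2 = i
  rw [this]

/-- Matching inside fine cells takes the same mass from both measures in every coarser cell, so
coarse excesses can be computed from the original measures instead of the remainders. -/
lemma sub_remainder {f g : E → ι} (hg : Measurable g)
    (hfg : ∀ x y, f x = f y → g x = g y) {π : Measure (E × E)} {α β α' β' : Measure E}
    [IsFiniteMeasure α]
    (hα : α = π.map Prod.fst + α') (hβ : β = π.map Prod.snd + β')
    (hπ : π {z | f z.1 ≠ f z.2} = 0) (i : ι) :
    α' (g ⁻¹' {i}) - β' (g ⁻¹' {i}) = α (g ⁻¹' {i}) - β (g ⁻¹' {i}) ∧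
    β' (g ⁻¹' {i}) - α' (g ⁻¹' {i}) = β (g ⁻¹' {i}) - α (g ⁻¹' {i}) := by
  have hfin : π.map Prod.snd (g ⁻¹' {i}) ≠ ∞ := by
    rw [← apply_fst_eq_apply_snd hg hfg hπ]
    have : π.map Prod.fst (g ⁻¹' {i}) ≤ α (g ⁻¹' {i}) := by
      conv_rhs => rw [hα]
      simp
    exact ne_top_of_le_ne_top (by simp) this
  have h1 : α (g ⁻¹' {i}) = π.map Prod.snd (g ⁻¹' {i}) + α' (g ⁻¹' {i}) := by
    conv_lhs => rw [hα]
    rw [Measure.add_apply, apply_fst_eq_apply_snd hg hfg hπ]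
  have h2 : β (g ⁻¹' {i}) = π.map Prod.snd (g ⁻¹' {i}) + β' (g ⁻¹' {i}) := by
    conv_lhs => rw [hβ]
    rw [Measure.add_apply]
  rw [h1, h2]
  exact ⟨(ENNReal.add_sub_add_eq_sub_left hfin).symm, (ENNReal.add_sub_add_eq_sub_left hfin).symm⟩

/-- The weight depends on the label only, so it can be integrated against the second marginal, which
β dominates. -/
lemma lintegral_cost_le {f : E → ι} (hf : Measurable f) {c : E × E → ℝ≥0∞} {w : ι → ℝ≥0∞}
    {δ : ℝ≥0∞} (hc : ∀ x y, f x = f y → c (x, y) ≤ δ * w (f y)) {π : Measure (E × E)}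
    {β β' : Measure E} (hβ : β = π.map Prod.snd + β') (hπ : π {z | f z.1 ≠ f z.2} = 0) :
    ∫⁻ z, c z ∂π ≤ δ * ∫⁻ y, w (f y) ∂β := by
  have hwf : Measurable fun y => w (f y) := (measurable_of_countable w).comp hf
  have hae : ∀ᵐ z ∂π, f z.1 = f z.2 := by
    rw [ae_iff]; exact hπ
  calc ∫⁻ z, c z ∂π ≤ ∫⁻ z, δ * w (f z.2) ∂π := by
        refine lintegral_mono_ae ?_
        filter_upwards [hae] with z hz using hc _ _ hz
    _ = δ * ∫⁻ z, w (f z.2) ∂π := lintegral_const_mul _ (hwf.comp measurable_snd)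
    _ = δ * ∫⁻ y, w (f y) ∂(π.map Prod.snd) := by rw [lintegral_map hwf measurable_snd]
    _ ≤ δ * ∫⁻ y, w (f y) ∂β := by
        gcongr
        rw [hβ]
        exact Measure.le_add_right le_rfl

/-- Induction on the number of levels: match in the finest cells, at a cost of δ times the weight of
β; the unmatched part of β weighs exactly the excess at that level and is left to the coarser
levels. Since the induction is applied to the remainders, α and β are quantified after `L`. -/
lemma exists_multiscale_coupling {f : ℕ → E → ι} (hf : ∀ l, Measurable (f l))
    (hnest : ∀ l x y, f (l + 1) x = f (l + 1) y → f l x = f l y)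
    {c : E × E → ℝ≥0∞} {w : ι → ℝ≥0∞} {δ : ℕ → ℝ≥0∞}
    (hw : ∀ l x, w (f l x) = w (f 0 x))
    (hc : ∀ l x y, f l x = f l y → c (x, y) ≤ δ l * w (f l y)) (L : ℕ) :
    ∀ (α β : Measure E) [IsFiniteMeasure α] [IsFiniteMeasure β],
    ∃ (π : Measure (E × E)) (α' β' : Measure E),
      α = π.map Prod.fst + α' ∧ β = π.map Prod.snd + β' ∧
      (∀ i, α' (f 0 ⁻¹' {i}) = α (f 0 ⁻¹' {i}) - β (f 0 ⁻¹' {i})) ∧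
      (∀ i, β' (f 0 ⁻¹' {i}) = β (f 0 ⁻¹' {i}) - α (f 0 ⁻¹' {i})) ∧
      ∫⁻ z, c z ∂π ≤ δ L * ∫⁻ y, w (f 0 y) ∂β
        + ∑ l ∈ Finset.range L, δ l * cellExcess (f (l + 1)) w β α := by
  have hnest' : ∀ l k x y, f (l + k) x = f (l + k) y → f l x = f l y := by
    intro l k
    induction k with
    | zero => exact fun x y h => h
    | succ k ih => exact fun x y h => ih x y (hnest _ _ _ h)
  have hnest'' : ∀ {l k : ℕ}, l ≤ k → ∀ x y, f k x = f k y → f l x = f l y := by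
    intro l k hlk x y h
    obtain ⟨j, rfl⟩ := Nat.exists_eq_add_of_le hlk
    exact hnest' l j x y h
  induction L with
  | zero =>
    intro α β _ _
    obtain ⟨π, α', β', hα, hβ, hπ, hα', hβ'⟩ := exists_partial_coupling (hf 0) α β
    refine ⟨π, α', β', hα, hβ, hα', hβ', ?_⟩
    simpa using lintegral_cost_le (hf 0) (hc 0) hβ hπ
  | succ L ih =>
    intro α β _ _
    obtain ⟨π, α', β', hα, hβ, hπ, hα', hβ'⟩ := exists_partial_coupling (hf (L + 1)) α β
    have : IsFiniteMeasure α' := isFiniteMeasure_of_le α (by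
      conv_rhs => rw [hα]
      exact Measure.le_add_left le_rfl)
    have : IsFiniteMeasure β' := isFiniteMeasure_of_le β (by
      conv_rhs => rw [hβ]
      exact Measure.le_add_left le_rfl)
    obtain ⟨π₁, α₁, β₁, hα₁, hβ₁, hα₁', hβ₁', hcost⟩ := ih α' β'
    refine ⟨π + π₁, α₁, β₁, ?_, ?_, fun i => ?_, fun i => ?_, ?_⟩
    · rw [Measure.map_add _ _ measurable_fst, add_assoc, ← hα₁, ← hα]
    · rw [Measure.map_add _ _ measurable_snd, add_assoc, ← hβ₁, ← hβ]
    · rw [hα₁']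
      exact (sub_remainder (hf 0) (hnest'' (Nat.zero_le (L + 1))) hα hβ hπ i).1
    · rw [hβ₁']
      exact (sub_remainder (hf 0) (hnest'' (Nat.zero_le (L + 1))) hα hβ hπ i).2
    · rw [lintegral_add_measure, Finset.sum_range_succ]
      have h1 := lintegral_cost_le (hf (L + 1)) (hc (L + 1)) hβ hπ
      simp_rw [hw (L + 1)] at h1
      have h2 : ∫⁻ y, w (f 0 y) ∂β' = cellExcess (f (L + 1)) w β α := by
        simp_rw [← hw (L + 1)]
        rw [lintegral_label (hf (L + 1)), cellExcess]
        simp_rw [hβ']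
      have h3 : ∀ l ∈ Finset.range L,
          δ l * cellExcess (f (l + 1)) w β' α' = δ l * cellExcess (f (l + 1)) w β α := by
        intro l hl
        have hl' : l + 1 ≤ L + 1 := by
          have := Finset.mem_range.1 hl
          omega
        simp only [cellExcess]
        congr 1
        refine tsum_congr fun i => ?_
        rw [(sub_remainder (hf (l + 1)) (hnest'' hl') hα hβ hπ i).2]
      rw [Finset.sum_congr rfl h3, h2] at hcost
      calc _ ≤ _ := add_le_add h1 hcost
        _ = _ := by ring

/-- Two probability measures are coupled at the cost of the multiscale excesses over nested
partitions, plus the cost of the finest cells. -/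
lemma exists_coupling_cost_le {f : ℕ → E → ι} (hf : ∀ l, Measurable (f l))
    (hnest : ∀ l x y, f (l + 1) x = f (l + 1) y → f l x = f l y)
    {c : E × E → ℝ≥0∞} {w : ι → ℝ≥0∞} {δ : ℕ → ℝ≥0∞}
    (hw : ∀ l x, w (f l x) = w (f 0 x))
    (hc : ∀ l x y, f l x = f l y → c (x, y) ≤ δ l * w (f l y))
    (hc₀ : ∀ x y, c (x, y) ≤ w (f 0 x) + w (f 0 y)) (L : ℕ)
    (α β : Measure E) [IsProbabilityMeasure α] [IsProbabilityMeasure β] :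
    ∃ π : Measure (E × E), IsProbabilityMeasure π ∧ π.map Prod.fst = α ∧ π.map Prod.snd = β ∧
      ∫⁻ z, c z ∂π ≤ δ L * ∫⁻ y, w (f 0 y) ∂β
        + ∑ l ∈ Finset.range L, δ l * cellExcess (f (l + 1)) w β α
        + (cellExcess (f 0) w α β + cellExcess (f 0) w β α) := by
  obtain ⟨π, α', β', hα, hβ, hα', hβ', hcost⟩ :=
    exists_multiscale_coupling hf hnest hw hc L α β
  have : IsFiniteMeasure α' := isFiniteMeasure_of_le α (by
    conv_rhs => rw [hα]
    exact Measure.le_add_left le_rfl)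
  have : IsFiniteMeasure β' := isFiniteMeasure_of_le β (by
    conv_rhs => rw [hβ]
    exact Measure.le_add_left le_rfl)
  have hfinπ : π Set.univ ≠ ∞ := by
    have : π Set.univ ≤ α Set.univ := by
      conv_rhs => rw [hα]
      rw [Measure.add_apply, Measure.map_apply measurable_fst MeasurableSet.univ]
      simp
    exact ne_top_of_le_ne_top (by simp) this
  have hmass : α' Set.univ = β' Set.univ := by
    have h1 : α Set.univ = π Set.univ + α' Set.univ := by
      conv_lhs => rw [hα]
      rw [Measure.add_apply, Measure.map_apply measurable_fst MeasurableSet.univ]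
      simp
    have h2 : β Set.univ = π Set.univ + β' Set.univ := by
      conv_lhs => rw [hβ]
      rw [Measure.add_apply, Measure.map_apply measurable_snd MeasurableSet.univ]
      simp
    rw [measure_univ] at h1 h2
    exact (ENNReal.add_right_inj hfinπ).1 (h1.symm.trans h2)
  set t := β' Set.univ with ht
  have htfin : t ≠ ∞ := by simp [ht]
  have hwm : Measurable fun x => w (f 0 x) := (measurable_of_countable w).comp (hf 0)
  -- The mass left over after level 0 is coupled by the normalized product. If t = 0 then t⁻¹ = ∞,
  -- but both remainders vanish.
  have hone_l : t⁻¹ • t • α' = α' := by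
    rcases eq_or_ne t 0 with h0 | h0
    · have : α' = 0 := Measure.measure_univ_eq_zero.1 (hmass.trans h0)
      simp [this]
    · rw [smul_smul, ENNReal.inv_mul_cancel h0 htfin, one_smul]
  have hone_r : t⁻¹ • t • β' = β' := by
    rcases eq_or_ne t 0 with h0 | h0
    · have : β' = 0 := Measure.measure_univ_eq_zero.1 h0
      simp [this]
    · rw [smul_smul, ENNReal.inv_mul_cancel h0 htfin, one_smul]
  have hfst : (t⁻¹ • α'.prod β').map Prod.fst = α' := by
    rw [Measure.map_smul, Measure.map_fst_prod, ← ht, hone_l]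
  have hsnd : (t⁻¹ • α'.prod β').map Prod.snd = β' := by
    rw [Measure.map_smul, Measure.map_snd_prod, hmass, hone_r]
  have hmfst : (π + t⁻¹ • α'.prod β').map Prod.fst = α := by
    rw [Measure.map_add _ _ measurable_fst, hfst, ← hα]
  refine ⟨π + t⁻¹ • α'.prod β', ⟨?_⟩, hmfst, ?_, ?_⟩
  · have : (π + t⁻¹ • α'.prod β').map Prod.fst Set.univ = 1 := by rw [hmfst]; simp
    rwa [Measure.map_apply measurable_fst MeasurableSet.univ] at this
  · rw [Measure.map_add _ _ measurable_snd, hsnd, ← hβ]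
  · rw [lintegral_add_measure]
    refine add_le_add hcost ?_
    calc ∫⁻ z, c z ∂(t⁻¹ • α'.prod β')
        ≤ ∫⁻ z, (w (f 0 z.1) + w (f 0 z.2)) ∂(t⁻¹ • α'.prod β') :=
          lintegral_mono fun z => hc₀ _ _
      _ = ∫⁻ x, w (f 0 x) ∂((t⁻¹ • α'.prod β').map Prod.fst)
          + ∫⁻ x, w (f 0 x) ∂((t⁻¹ • α'.prod β').map Prod.snd) := by
          rw [lintegral_map hwm measurable_fst, lintegral_map hwm measurable_snd]
          exact lintegral_add_left (hwm.comp measurable_fst) _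
      _ = cellExcess (f 0) w α β + cellExcess (f 0) w β α := by
          rw [hfst, hsnd, lintegral_label (hf 0), lintegral_label (hf 0), cellExcess, cellExcess]
          simp_rw [hα', hβ']

end Multiscale

/-! ### Dyadic shells and cubes; the transport cost as a multiscale sum -/

section Cells

variable {d : ℕ}

/-- The index of the dyadic shell `{s 2^(m-1) < |y| ≤ s 2^m}` (the ball `{|y| ≤ s}` for `m = 0`)
that contains `y`. -/
noncomputable def shell (s : ℝ) (y : EuclideanSpace ℝ (Fin d)) : ℕ :=
  ⌈Real.logb 2 (‖y.ofLp‖ / s)⌉₊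

/-- The label of the cell of `y` in the subdivision of each shell into cubes of relative side
`2^(-l)`. -/
noncomputable def cellLabel (s : ℝ) (l : ℕ) (y : EuclideanSpace ℝ (Fin d)) : ℕ × (Fin d → ℤ) :=
  (shell s y, fun i => ⌊2 ^ l * (y i / (s * 2 ^ shell s y))⌋)

lemma norm_le_shell {s : ℝ} (hs : 0 < s) (y : EuclideanSpace ℝ (Fin d)) :
    ‖y.ofLp‖ ≤ s * 2 ^ shell s y := by
  rcases (norm_nonneg y.ofLp).eq_or_lt with h | h
  · rw [← h]; positivity
  · have h1 : Real.logb 2 (‖y.ofLp‖ / s) ≤ (shell s y : ℝ) := Nat.le_ceil _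
    rw [Real.logb_le_iff_le_rpow (by norm_num) (by positivity), Real.rpow_natCast,
      div_le_iff₀ hs] at h1
    linarith

lemma lt_norm_of_lt_shell {s : ℝ} (hs : 0 < s) {y : EuclideanSpace ℝ (Fin d)} {M : ℕ}
    (h : M < shell s y) : s * 2 ^ M < ‖y.ofLp‖ := by
  rw [shell, Nat.lt_ceil] at h
  rcases (norm_nonneg y.ofLp).eq_or_lt with h0 | h0
  -- As `Real.logb 2 0 = 0`, the origin belongs to shell 0.
  · rw [← h0] at h
    have : (0 : ℝ) ≤ M := Nat.cast_nonneg M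
    simp at h
    linarith
  · rw [Real.lt_logb_iff_rpow_lt (by norm_num) (by positivity), Real.rpow_natCast,
      lt_div_iff₀ hs] at h
    linarith

lemma measurable_shell (s : ℝ) : Measurable (shell s : EuclideanSpace ℝ (Fin d) → ℕ) := by
  unfold shell Real.logb
  have : Measurable fun y : EuclideanSpace ℝ (Fin d) => ‖y.ofLp‖ :=
    (by fun_prop : Continuous fun y : EuclideanSpace ℝ (Fin d) => ‖y.ofLp‖).measurable
  exact Nat.measurable_ceil.comp ((Real.measurable_log.comp (this.div_const s)).div_const _)

lemma measurable_cellLabel (s : ℝ) (l : ℕ) :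
    Measurable (cellLabel s l : EuclideanSpace ℝ (Fin d) → ℕ × (Fin d → ℤ)) := by
  refine (measurable_shell s).prodMk (measurable_pi_lambda _ fun i => ?_)
  have h1 : Measurable fun y : EuclideanSpace ℝ (Fin d) => y i :=
    (by fun_prop : Continuous fun y : EuclideanSpace ℝ (Fin d) => y i).measurable
  have h2 : Measurable fun y : EuclideanSpace ℝ (Fin d) => s * 2 ^ shell s y :=
    (measurable_of_countable fun m : ℕ => s * 2 ^ m).comp (measurable_shell s)
  exact Int.measurable_floor.comp ((h1.div h2).const_mul _)

/-- The shell does not depend on l, and ⌊2^l z⌋ is the integer half of ⌊2^(l+1) z⌋. -/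
lemma cellLabel_nested (s : ℝ) (l : ℕ) (x y : EuclideanSpace ℝ (Fin d))
    (h : cellLabel s (l + 1) x = cellLabel s (l + 1) y) : cellLabel s l x = cellLabel s l y := by
  have key : ∀ z : ℝ, ⌊2 ^ l * z⌋ = ⌊2 ^ (l + 1) * z⌋ / 2 := by
    intro z
    have := Int.floor_div_natCast ((2 : ℝ) ^ (l + 1) * z) 2
    push_cast at this
    rw [← this]
    congr 1
    ring
  simp only [cellLabel, Prod.mk.injEq] at h ⊢
  refine ⟨h.1, funext fun i => ?_⟩
  rw [key, key]
  exact congrArg (· / 2) (congrFun h.2 i)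

lemma norm_le_card_mul {y : EuclideanSpace ℝ (Fin d)} {c : ℝ} (hc : 0 ≤ c)
    (h : ∀ i, |y i| ≤ c) : ‖y‖ ≤ d * c := by
  rw [EuclideanSpace.norm_eq]
  refine Real.sqrt_le_iff.2 ⟨by positivity, ?_⟩
  calc ∑ i, ‖y i‖ ^ 2 ≤ ∑ _i : Fin d, c ^ 2 := by
        refine Finset.sum_le_sum fun i _ => ?_
        have := h i
        rw [Real.norm_eq_abs]
        gcongr
    _ = d * c ^ 2 := by simp
    _ ≤ (d * c) ^ 2 := by
        rw [mul_pow]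
        gcongr
        rcases Nat.eq_zero_or_pos d with h0 | h0
        · simp [h0]
        · have : (1 : ℝ) ≤ d := by exact_mod_cast h0
          nlinarith

lemma norm_sub_le_of_cellLabel_eq {s : ℝ} (hs : 0 < s) {l : ℕ}
    {x y : EuclideanSpace ℝ (Fin d)} (h : cellLabel s l x = cellLabel s l y) :
    ‖x - y‖ ≤ d * (s * 2 ^ shell s y * (2 ^ l)⁻¹) := by
  simp only [cellLabel, Prod.mk.injEq] at h
  refine norm_le_card_mul (by positivity) fun i => ?_
  have h1 := Int.abs_sub_lt_one_of_floor_eq_floor (congrFun h.2 i)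
  rw [h.1, ← mul_sub, ← sub_div, abs_mul, abs_div, abs_of_pos (by positivity : (0 : ℝ) < 2 ^ l),
    abs_of_pos (by positivity : 0 < s * 2 ^ shell s y), ← mul_div_assoc,
    div_lt_one (by positivity)] at h1
  rw [← div_eq_mul_inv, le_div_iff₀ (by positivity)]
  have : (x - y) i = x i - y i := rfl
  rw [this]
  linarith

lemma norm_le_shell' {s : ℝ} (hs : 0 < s) (y : EuclideanSpace ℝ (Fin d)) :
    ‖y‖ ≤ d * (s * 2 ^ shell s y) :=
  norm_le_card_mul (by positivity) fun i =>
    (norm_le_pi_norm y.ofLp i).trans (norm_le_shell hs y)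

/-- The labels of the cubes of relative side `2^(-l)` that meet a shell. -/
noncomputable def labelBox (d l : ℕ) : Finset (Fin d → ℤ) :=
  Fintype.piFinset fun _ => Finset.Icc (-2 ^ l) (2 ^ l)

lemma card_labelBox_le (d l : ℕ) : (labelBox d l).card ≤ 4 ^ d * 2 ^ (d * l) := by
  rw [labelBox, Fintype.card_piFinset]
  simp only [Int.card_Icc, Finset.prod_const, Finset.card_univ, Fintype.card_fin]
  rw [pow_mul', ← mul_pow]
  refine Nat.pow_le_pow_left ?_ d
  have : (1 : ℤ) ≤ 2 ^ l := one_le_pow₀ (by norm_num)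
  have h : ((2 : ℤ) ^ l + 1 - -2 ^ l).toNat ≤ ((4 * 2 ^ l : ℤ)).toNat := Int.toNat_le_toNat (by linarith)
  refine h.trans (le_of_eq ?_)
  exact Int.toNat_natCast (4 * 2 ^ l)

lemma cellLabel_snd_mem {s : ℝ} (hs : 0 < s) (l : ℕ) (y : EuclideanSpace ℝ (Fin d)) :
    (cellLabel s l y).2 ∈ labelBox d l := by
  rw [labelBox, Fintype.mem_piFinset]
  intro i
  have h1 : |y i| ≤ s * 2 ^ shell s y := (norm_le_pi_norm y.ofLp i).trans (norm_le_shell hs y)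
  have h2 : |y i / (s * 2 ^ shell s y)| ≤ 1 := by
    rw [abs_div, abs_of_pos (by positivity : 0 < s * 2 ^ shell s y)]
    exact div_le_one_of_le₀ h1 (by positivity)
  have h3 := abs_le.1 h2
  have h4 : (0 : ℝ) < 2 ^ l := by positivity
  simp only [cellLabel, Finset.mem_Icc]
  constructor
  · rw [Int.le_floor]
    push_cast
    nlinarith
  · have : ⌊2 ^ l * (y i / (s * 2 ^ shell s y))⌋ ≤ ⌊((2 ^ l : ℤ) : ℝ)⌋ := by
      refine Int.floor_le_floor ?_
      push_cast
      nlinarith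
    simpa only [Int.floor_intCast] using this

lemma shell_eq_of_cell {s : ℝ} {l : ℕ} {i : ℕ × (Fin d → ℤ)} {y : EuclideanSpace ℝ (Fin d)}
    (h : y ∈ cellLabel s l ⁻¹' {i}) : shell s y = i.1 := by
  rw [← (h : cellLabel s l y = i)]
  rfl

lemma cell_eq_empty {s : ℝ} (hs : 0 < s) {l : ℕ} {i : ℕ × (Fin d → ℤ)}
    (h : i.2 ∉ labelBox d l) :
    (cellLabel s l ⁻¹' {i} : Set (EuclideanSpace ℝ (Fin d))) = ∅ := by
  refine Set.eq_empty_of_forall_notMem fun y hy => h ?_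
  rw [← (hy : cellLabel s l y = i)]
  exact cellLabel_snd_mem hs l y

/-- The multiscale functional that dominates the transport cost. -/
noncomputable def multiscaleSum (p s : ℝ)
    (D : Set (EuclideanSpace ℝ (Fin d)) → ℝ≥0∞) : ℝ≥0∞ :=
  ∑' l : ℕ, ENNReal.ofReal (2 ^ (-(p * l))) * ∑' i : ℕ × (Fin d → ℤ),
    ENNReal.ofReal ((s * 2 ^ i.1) ^ p) * D (cellLabel s l ⁻¹' {i})

/-- The coupling bound is applied with L levels and L → ∞. It pairs the factor of level l with the
excess of level l + 1; realigning them costs 2^p, whence 2^p (2d)^p = (4d)^p. -/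
lemma wassersteinPow_le_multiscaleSum {p s : ℝ} (hp : 1 ≤ p) (hs : 0 < s)
    (α β : Measure (EuclideanSpace ℝ (Fin d))) [IsProbabilityMeasure α] [IsProbabilityMeasure β]
    (hβ : ∫⁻ y, ENNReal.ofReal ((s * 2 ^ shell s y) ^ p) ∂β ≠ ∞) :
    wassersteinPow p α β ≤
      ENNReal.ofReal ((4 * d) ^ p) * multiscaleSum p s fun A => (α A - β A) + (β A - α A) := by
  have hp0 : 0 ≤ p := by linarith
  -- Inside a cell d^p would do; the extra 2^p serves `hc₀`, where x and y may lie in different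
  -- shells.
  set w : ℕ × (Fin d → ℤ) → ℝ≥0∞ := fun i =>
    ENNReal.ofReal ((2 * d) ^ p) * ENNReal.ofReal ((s * 2 ^ i.1) ^ p) with hw
  set δ : ℕ → ℝ≥0∞ := fun l => ENNReal.ofReal (2 ^ (-(p * l))) with hδ
  have hδ1 : ∀ l : ℕ, δ l = ENNReal.ofReal (2 ^ p) * δ (l + 1) := by
    intro l
    rw [hδ]
    simp only
    rw [← ENNReal.ofReal_mul (by positivity), ← Real.rpow_add (by norm_num)]
    congr 2
    push_cast
    ring
  have hc : ∀ l (x y : EuclideanSpace ℝ (Fin d)), cellLabel s l x = cellLabel s l y →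
      ENNReal.ofReal (‖x - y‖ ^ p) ≤ δ l * w (cellLabel s l y) := by
    intro l x y h
    rw [hδ, hw]
    simp only
    rw [← ENNReal.ofReal_mul (by positivity), ← ENNReal.ofReal_mul (by positivity)]
    refine ENNReal.ofReal_le_ofReal ?_
    have h1 := norm_sub_le_of_cellLabel_eq hs h
    calc ‖x - y‖ ^ p ≤ (d * (s * 2 ^ shell s y * (2 ^ l)⁻¹)) ^ p :=
          Real.rpow_le_rpow (norm_nonneg _) h1 hp0
      _ = 2 ^ (-(p * l)) * ((d : ℝ) ^ p * (s * 2 ^ shell s y) ^ p) := by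
          rw [Real.mul_rpow (by positivity) (by positivity),
            Real.mul_rpow (by positivity) (by positivity), Real.inv_rpow (by positivity),
            ← Real.rpow_natCast 2 l, ← Real.rpow_mul (by norm_num), ← Real.rpow_neg (by norm_num),
            mul_comm (l : ℝ) p]
          ring
      _ ≤ 2 ^ (-(p * l)) * ((2 * d : ℝ) ^ p * (s * 2 ^ (cellLabel s l y).1) ^ p) := by
          change _ ≤ 2 ^ (-(p * l)) * ((2 * d : ℝ) ^ p * (s * 2 ^ shell s y) ^ p)
          gcongr
          have : (0 : ℝ) ≤ d := Nat.cast_nonneg d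
          linarith
  have hc₀ : ∀ x y : EuclideanSpace ℝ (Fin d),
      ENNReal.ofReal (‖x - y‖ ^ p) ≤ w (cellLabel s 0 x) + w (cellLabel s 0 y) := by
    intro x y
    rw [hw]
    simp only
    rw [← ENNReal.ofReal_mul (by positivity), ← ENNReal.ofReal_mul (by positivity),
      ← ENNReal.ofReal_add (by positivity) (by positivity)]
    refine ENNReal.ofReal_le_ofReal ?_
    change _ ≤ (2 * d : ℝ) ^ p * (s * 2 ^ shell s x) ^ p + (2 * d : ℝ) ^ p * (s * 2 ^ shell s y) ^ p
    set a := s * 2 ^ shell s x with ha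
    set b := s * 2 ^ shell s y with hb
    have ha0 : 0 ≤ a := by positivity
    have hb0 : 0 ≤ b := by positivity
    have h1 : ‖x - y‖ ≤ 2 * d * max a b := by
      have hx := norm_le_shell' hs x
      have hy := norm_le_shell' hs y
      have h2 : (d : ℝ) * a ≤ d * max a b := by gcongr; exact le_max_left _ _
      have h3 : (d : ℝ) * b ≤ d * max a b := by gcongr; exact le_max_right _ _
      have := norm_sub_le x y
      linarith
    calc ‖x - y‖ ^ p ≤ (2 * d * max a b) ^ p := Real.rpow_le_rpow (norm_nonneg _) h1 hp0
      _ = (2 * d : ℝ) ^ p * (max a b) ^ p := by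
          rw [Real.mul_rpow (by positivity) (by positivity)]
      _ ≤ (2 * d : ℝ) ^ p * (a ^ p + b ^ p) := by
          gcongr
          rcases le_total a b with h | h
          · rw [max_eq_right h]
            have : 0 ≤ a ^ p := by positivity
            linarith
          · rw [max_eq_left h]
            have : 0 ≤ b ^ p := by positivity
            linarith
      _ = _ := by ring
  set S := multiscaleSum p s fun A => (α A - β A) + (β A - α A) with hS
  have hwint : ∫⁻ y, w (cellLabel s 0 y) ∂β ≠ ∞ := by
    have : ∫⁻ y, w (cellLabel s 0 y) ∂β
        = ENNReal.ofReal ((2 * d) ^ p) * ∫⁻ y, ENNReal.ofReal ((s * 2 ^ shell s y) ^ p) ∂β := by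
      rw [← lintegral_const_mul' _ _ ENNReal.ofReal_ne_top]
      rfl
    rw [this]
    exact ENNReal.mul_ne_top ENNReal.ofReal_ne_top hβ
  have hterm : ∀ l, cellExcess (cellLabel s l) w α β + cellExcess (cellLabel s l) w β α
      = ENNReal.ofReal ((2 * d) ^ p) * ∑' i : ℕ × (Fin d → ℤ), ENNReal.ofReal ((s * 2 ^ i.1) ^ p) *
        ((α (cellLabel s l ⁻¹' {i}) - β (cellLabel s l ⁻¹' {i}))
          + (β (cellLabel s l ⁻¹' {i}) - α (cellLabel s l ⁻¹' {i}))) := by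
    intro l
    rw [cellExcess, cellExcess, ← ENNReal.tsum_add, ← ENNReal.tsum_mul_left]
    refine tsum_congr fun i => ?_
    rw [hw]
    ring
  have hsum : ∑' l, δ l * (cellExcess (cellLabel s l) w α β + cellExcess (cellLabel s l) w β α)
      = ENNReal.ofReal ((2 * d) ^ p) * S := by
    simp_rw [hterm]
    rw [hS, multiscaleSum, ← ENNReal.tsum_mul_left]
    refine tsum_congr fun l => ?_
    ring
  have hbound : ∀ L, wassersteinPow p α β ≤ δ L * ∫⁻ y, w (cellLabel s 0 y) ∂β
      + ENNReal.ofReal ((4 * d) ^ p) * S := by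
    intro L
    obtain ⟨π, hπ, h1, h2, hcost⟩ := exists_coupling_cost_le (f := cellLabel s)
      (measurable_cellLabel s) (cellLabel_nested s) (c := fun z => ENNReal.ofReal (‖z.1 - z.2‖ ^ p))
      (w := w) (δ := δ) (fun l x => rfl) hc hc₀ L α β
    refine (iInf₂_le π (show π ∈ couplings α β from ⟨hπ, h1, h2⟩)).trans (hcost.trans ?_)
    rw [add_assoc]
    refine add_le_add le_rfl ?_
    have h2p : (1 : ℝ≥0∞) ≤ ENNReal.ofReal (2 ^ p) := by
      rw [← ENNReal.ofReal_one]
      exact ENNReal.ofReal_le_ofReal (Real.one_le_rpow (by norm_num) hp0)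
    have hδ0 : δ 0 = 1 := by simp [hδ]
    calc ∑ l ∈ Finset.range L, δ l * cellExcess (cellLabel s (l + 1)) w β α
          + (cellExcess (cellLabel s 0) w α β + cellExcess (cellLabel s 0) w β α)
        ≤ ∑ l ∈ Finset.range L, ENNReal.ofReal (2 ^ p) * (δ (l + 1) *
            (cellExcess (cellLabel s (l + 1)) w α β + cellExcess (cellLabel s (l + 1)) w β α))
          + ENNReal.ofReal (2 ^ p) * (δ 0 *
            (cellExcess (cellLabel s 0) w α β + cellExcess (cellLabel s 0) w β α)) := by
          refine add_le_add (Finset.sum_le_sum fun l _ => ?_) ?_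
          · rw [hδ1 l, mul_assoc]
            gcongr
            exact le_add_self
          · rw [hδ0, one_mul]
            exact le_mul_of_one_le_left zero_le h2p
      _ = ENNReal.ofReal (2 ^ p) * ∑ l ∈ Finset.range (L + 1), (δ l *
            (cellExcess (cellLabel s l) w α β + cellExcess (cellLabel s l) w β α)) := by
          rw [Finset.sum_range_succ', mul_add (ENNReal.ofReal (2 ^ p)), Finset.mul_sum]
      _ ≤ ENNReal.ofReal (2 ^ p) * (ENNReal.ofReal ((2 * d) ^ p) * S) := by
          rw [← hsum]
          gcongr
          exact ENNReal.sum_le_tsum _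
      _ = ENNReal.ofReal ((4 * d) ^ p) * S := by
          rw [← mul_assoc, ← ENNReal.ofReal_mul (by positivity),
            ← Real.mul_rpow (by norm_num) (by positivity)]
          congr 3
          ring
  -- The cost of the finest cells vanishes because the weight has a finite integral, which is where
  -- `hβ` enters.
  have hlim : Filter.Tendsto (fun L => δ L * ∫⁻ y, w (cellLabel s 0 y) ∂β
      + ENNReal.ofReal ((4 * d) ^ p) * S) Filter.atTop
      (nhds (0 * ∫⁻ y, w (cellLabel s 0 y) ∂β + ENNReal.ofReal ((4 * d) ^ p) * S)) := by
    refine Filter.Tendsto.add (ENNReal.Tendsto.mul_const ?_ (Or.inr hwint)) tendsto_const_nhds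
    have h1 : ∀ l : ℕ, δ l = ENNReal.ofReal (((2 : ℝ) ^ (-p)) ^ l) := by
      intro l
      rw [hδ, ← Real.rpow_natCast, ← Real.rpow_mul (by norm_num), neg_mul]
    rw [show δ = _ from funext h1]
    rw [← ENNReal.ofReal_zero]
    refine ENNReal.tendsto_ofReal (tendsto_pow_atTop_nhds_zero_of_lt_one (by positivity) ?_)
    exact Real.rpow_lt_one_of_one_lt_of_neg (by norm_num) (by linarith)
  rw [zero_mul, zero_add] at hlim
  exact ge_of_tendsto' hlim hbound

end Cells

/-! ### Doob's maximal inequality in L², by a pathwise argument -/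

section Maximal

/-- The running maximum of `|S 0|, …, |S n|`. -/
def runMax (S : ℕ → ℝ) : ℕ → ℝ
  | 0 => |S 0|
  | k + 1 => max (runMax S k) |S (k + 1)|

lemma runMax_nonneg (S : ℕ → ℝ) (n : ℕ) : 0 ≤ runMax S n := by
  induction n with
  | zero => exact abs_nonneg _
  | succ k ih => exact le_max_of_le_left ih

lemma abs_le_runMax (S : ℕ → ℝ) {k n : ℕ} (h : k ≤ n) : |S k| ≤ runMax S n := by
  induction n with
  | zero => rw [Nat.le_zero.1 h]; exact le_rfl
  | succ n ih =>
    rcases Nat.le_succ_iff.1 h with h | rfl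
    · exact (ih h).trans (le_max_left _ _)
    · exact le_max_right _ _

lemma runMax_le {S : ℕ → ℝ} {n : ℕ} {c : ℝ} (h : ∀ k ≤ n, |S k| ≤ c) : runMax S n ≤ c := by
  induction n with
  | zero => exact h 0 le_rfl
  | succ n ih => exact max_le (ih fun k hk => h k (hk.trans n.le_succ)) (h _ le_rfl)

/-- The pathwise form of Doob's maximal inequality in `L²`. -/
lemma runMax_sq_le (S : ℕ → ℝ) (n : ℕ) :
    runMax S n ^ 2 ≤ 4 * S n ^ 2
      - 4 * ∑ k ∈ Finset.range n, runMax S k * SignType.sign (S k) * (S (k + 1) - S k) := by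
  -- The sign of S k is a subgradient of |·| at S k, so each term of the sum is at most the running
  -- maximum times the increment of |S|; the induction is then a summation by parts.
  have key : ∀ n, runMax S n ^ 2
      + 2 * ∑ k ∈ Finset.range n, runMax S k * SignType.sign (S k) * (S (k + 1) - S k)
      ≤ 2 * runMax S n * |S n| := by
    intro n
    induction n with
    | zero =>
      simp only [runMax, Finset.range_zero, Finset.sum_empty]
      nlinarith [abs_nonneg (S 0)]
    | succ n ih =>
      have h1 : (SignType.sign (S n) : ℝ) * (S (n + 1) - S n) ≤ |S (n + 1)| - |S n| := by
        rcases lt_trichotomy (S n) 0 with h | h | h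
        · rw [sign_neg h, abs_of_neg h]
          have := neg_le_abs (S (n + 1))
          simp only [SignType.coe_neg, SignType.coe_one]
          linarith
        · rw [h]; simp
        · rw [sign_pos h, abs_of_pos h]
          have := le_abs_self (S (n + 1))
          simp only [SignType.coe_one]
          linarith
      have h2 := mul_le_mul_of_nonneg_left h1 (runMax_nonneg S n)
      rw [Finset.sum_range_succ, mul_assoc (runMax S n)]
      simp only [runMax]
      rcases le_total (runMax S n) |S (n + 1)| with h | h
      · rw [max_eq_right h]
        nlinarith [sq_nonneg (runMax S n - |S (n + 1)|)]
      · rw [max_eq_left h]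
        nlinarith
  -- With R the running maximum, 2 R |S| ≤ R²/2 + 2 S² absorbs half of the left-hand side; this is
  -- the source of the factor 4.
  nlinarith [key n, sq_nonneg (runMax S n - 2 * |S n|), sq_abs (S n)]

variable {Ω : Type*} [mΩ : MeasurableSpace Ω] {P : Measure Ω}

lemma measurable_runMax {m : MeasurableSpace Ω} {S : ℕ → Ω → ℝ} {n : ℕ}
    (h : ∀ k ≤ n, Measurable[m] (S k)) : Measurable[m] fun ω => runMax (fun k => S k ω) n := by
  induction n with
  | zero => exact (h 0 le_rfl).abs
  | succ n ih => exact (ih fun k hk => h k (hk.trans n.le_succ)).max (h _ le_rfl).abs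

lemma integral_mul_eq_zero_of_indep {m : MeasurableSpace Ω} (hm : m ≤ mΩ) {G ξ : Ω → ℝ}
    (hG : Measurable[m] G) (hξ : Measurable[mΩ] ξ)
    (hind : Indep (MeasurableSpace.comap ξ inferInstance) m P) (h0 : ∫ ω, ξ ω ∂P = 0) :
    ∫ ω, G ω * ξ ω ∂P = 0 := by
  have hind' : IndepFun G ξ P :=
    indep_of_indep_of_le_left hind.symm hG.comap_le
  rw [hind'.integral_fun_mul_eq_mul_integral (hG.mono hm le_rfl).aestronglyMeasurable
    hξ.aestronglyMeasurable, h0, mul_zero]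

variable [IsProbabilityMeasure P]

lemma integrable_of_abs_le {f : Ω → ℝ} (hf : Measurable f) {c : ℝ} (h : ∀ ω, |f ω| ≤ c) :
    Integrable f P :=
  Integrable.of_bound hf.aestronglyMeasurable c (.of_forall h)

/-- Doob's maximal inequality in `L²` for sums of bounded centred variables, each independent of
its past. -/
lemma integral_runMax_sq_le {n : ℕ} {ξ : ℕ → Ω → ℝ} {ℱ : ℕ → MeasurableSpace Ω} {σ : ℝ}
    (hℱ : ∀ k, ℱ k ≤ mΩ) (hmono : Monotone ℱ) (hmeas : ∀ k, Measurable[ℱ (k + 1)] (ξ k))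
    (hbd : ∀ k ω, |ξ k ω| ≤ 1)
    (hind : ∀ k < n, Indep (MeasurableSpace.comap (ξ k) inferInstance) (ℱ k) P)
    (hmean : ∀ k < n, ∫ ω, ξ k ω ∂P = 0) (hsq : ∀ k < n, ∫ ω, ξ k ω ^ 2 ∂P ≤ σ) :
    ∫ ω, runMax (fun k => ∑ i ∈ Finset.range k, ξ i ω) n ^ 2 ∂P ≤ 4 * (n * σ) := by
  set S : ℕ → Ω → ℝ := fun k ω => ∑ i ∈ Finset.range k, ξ i ω with hS
  have hξm : ∀ k, Measurable (ξ k) := fun k => (hmeas k).mono (hℱ _) le_rfl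
  have hSℱ : ∀ k, Measurable[ℱ k] (S k) := fun k =>
    Finset.measurable_sum _ fun i hi =>
      (hmeas i).mono (hmono (Finset.mem_range.1 hi)) le_rfl
  have hSm : ∀ k, Measurable (S k) := fun k => (hSℱ k).mono (hℱ k) le_rfl
  have hSbd : ∀ k ω, |S k ω| ≤ k := fun k ω => by
    refine (Finset.abs_sum_le_sum_abs _ _).trans ?_
    refine (Finset.sum_le_sum fun i _ => hbd i ω).trans ?_
    simp
  have hRℱ : ∀ k, Measurable[ℱ k] fun ω => runMax (fun k => S k ω) k := fun k =>
    measurable_runMax fun j hj => (hSℱ j).mono (hmono hj) le_rfl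
  have hRm : ∀ k, Measurable fun ω => runMax (fun k => S k ω) k := fun k =>
    (hRℱ k).mono (hℱ k) le_rfl
  have hRbd : ∀ k ω, |runMax (fun k => S k ω) k| ≤ k := fun k ω => by
    rw [abs_of_nonneg (runMax_nonneg _ _)]
    exact runMax_le fun j hj => (hSbd j ω).trans (by exact_mod_cast hj)
  have hsignm : Measurable fun x : ℝ => ((SignType.sign x : SignType) : ℝ) := by
    have : (fun x : ℝ => ((SignType.sign x : SignType) : ℝ))
        = fun x => if 0 < x then 1 else if x < 0 then -1 else 0 := by
      ext x
      rcases lt_trichotomy x 0 with h | h | h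
      · simp [h, h.not_gt]
      · simp [h]
      · simp [h]
    rw [this]
    exact Measurable.ite measurableSet_Ioi measurable_const
      (Measurable.ite measurableSet_Iio measurable_const measurable_const)
  have hsignbd : ∀ x : ℝ, |((SignType.sign x : SignType) : ℝ)| ≤ 1 := by
    intro x
    rcases lt_trichotomy x 0 with h | h | h <;> simp [h]
  -- Orthogonality of the increments: the cross term S k · ξ k integrates to zero.
  have hSsq : ∀ k ≤ n, ∫ ω, S k ω ^ 2 ∂P ≤ k * σ := by
    intro k
    induction k with
    | zero => intro _; simp [hS]
    | succ k ih =>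
      intro hk
      have h1 : ∀ ω, S (k + 1) ω ^ 2 = S k ω ^ 2 + (2 * (S k ω * ξ k ω) + ξ k ω ^ 2) := by
        intro ω
        have : S (k + 1) ω = S k ω + ξ k ω := Finset.sum_range_succ _ _
        rw [this]; ring
      have i1 : Integrable (fun ω => S k ω ^ 2) P :=
        integrable_of_abs_le (c := (k : ℝ) ^ 2) ((hSm k).pow_const 2) fun ω => by
          rw [abs_pow]; exact pow_le_pow_left₀ (abs_nonneg _) (hSbd k ω) 2
      have i2 : Integrable (fun ω => S k ω * ξ k ω) P :=
        integrable_of_abs_le (c := k * 1) ((hSm k).mul (hξm k)) fun ω => by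
          rw [abs_mul]
          exact mul_le_mul (hSbd k ω) (hbd k ω) (abs_nonneg _) (Nat.cast_nonneg k)
      have i3 : Integrable (fun ω => ξ k ω ^ 2) P :=
        integrable_of_abs_le (c := 1 ^ 2) ((hξm k).pow_const 2) fun ω => by
          rw [abs_pow]; exact pow_le_pow_left₀ (abs_nonneg _) (hbd k ω) 2
      simp_rw [h1]
      have i4 : Integrable (fun ω => 2 * (S k ω * ξ k ω) + ξ k ω ^ 2) P := (i2.const_mul 2).add i3
      rw [integral_add i1 i4, integral_add (i2.const_mul 2) i3, integral_const_mul,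
        integral_mul_eq_zero_of_indep (hℱ k) (hSℱ k) (hξm k) (hind k hk) (hmean k hk)]
      push_cast
      linarith [ih (by omega), hsq k hk]
  -- The coefficient of ξ k is bounded and depends on the past only, so the sum in the pathwise
  -- inequality has mean zero.
  have hT : ∀ k < n, ∫ ω, runMax (fun k => S k ω) k * SignType.sign (S k ω) * ξ k ω ∂P = 0 :=
    fun k hk => integral_mul_eq_zero_of_indep (hℱ k)
      ((hRℱ k).mul (hsignm.comp (hSℱ k))) (hξm k) (hind k hk) (hmean k hk)
  have hTint : ∀ k, Integrable
      (fun ω => runMax (fun k => S k ω) k * SignType.sign (S k ω) * ξ k ω) P := fun k =>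
    integrable_of_abs_le (c := k * 1 * 1)
      (((hRm k).mul (hsignm.comp (hSm k))).mul (hξm k)) fun ω => by
        rw [abs_mul, abs_mul]
        exact mul_le_mul (mul_le_mul (hRbd k ω) (hsignbd _) (abs_nonneg _) (Nat.cast_nonneg k))
          (hbd k ω) (abs_nonneg _) (by positivity)
  have iR : Integrable (fun ω => runMax (fun k => S k ω) n ^ 2) P :=
    integrable_of_abs_le (c := (n : ℝ) ^ 2) ((hRm n).pow_const 2) fun ω => by
      rw [abs_pow]; exact pow_le_pow_left₀ (abs_nonneg _) (hRbd n ω) 2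
  have iS : Integrable (fun ω => S n ω ^ 2) P :=
    integrable_of_abs_le (c := (n : ℝ) ^ 2) ((hSm n).pow_const 2) fun ω => by
      rw [abs_pow]; exact pow_le_pow_left₀ (abs_nonneg _) (hSbd n ω) 2
  have hpath : ∀ ω, runMax (fun k => S k ω) n ^ 2 ≤ 4 * S n ω ^ 2
      - 4 * ∑ k ∈ Finset.range n, runMax (fun k => S k ω) k * SignType.sign (S k ω) * ξ k ω := by
    intro ω
    have h1 : ∀ k, S (k + 1) ω - S k ω = ξ k ω := fun k => by
      simp only [hS, Finset.sum_range_succ]; ring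
    have := runMax_sq_le (fun k => S k ω) n
    simpa only [h1] using this
  calc ∫ ω, runMax (fun k => S k ω) n ^ 2 ∂P
      ≤ ∫ ω, (4 * S n ω ^ 2 - 4 * ∑ k ∈ Finset.range n,
          runMax (fun k => S k ω) k * SignType.sign (S k ω) * ξ k ω) ∂P :=
        integral_mono iR ((iS.const_mul 4).sub
          ((integrable_finsetSum _ fun k _ => hTint k).const_mul 4)) hpath
    _ = 4 * ∫ ω, S n ω ^ 2 ∂P := by
        rw [integral_sub (iS.const_mul 4)
          ((integrable_finsetSum _ fun k _ => hTint k).const_mul 4), integral_const_mul,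
          integral_const_mul, integral_finsetSum _ fun k _ => hTint k,
          Finset.sum_eq_zero fun k hk => hT k (Finset.mem_range.1 hk)]
        ring
    _ ≤ 4 * (n * σ) := by linarith [hSsq n le_rfl]

end Maximal

/-! ### Maximal deviations of the counting process of a set -/

section Deviation

variable {Ω E : Type*} [mΩ : MeasurableSpace Ω] [MeasurableSpace E] {n : ℕ}

/-- The variable `1_A(X k) - μ A`, and `0` past the end of the sample. -/
noncomputable def centredIndicator (X : Fin n → Ω → E) (μ : Measure E) (A : Set E) (k : ℕ)
    (ω : Ω) : ℝ :=
  if h : k < n then A.indicator 1 (X ⟨k, h⟩ ω) - μ.real A else 0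

/-- The maximum over `k ≤ n` of `|∑_{i < k} (1_A(X i) - μ A)|`. -/
noncomputable def maxDeviation (X : Fin n → Ω → E) (μ : Measure E) (A : Set E) (ω : Ω) : ℝ :=
  runMax (fun k => ∑ i ∈ Finset.range k, centredIndicator X μ A i ω) n

/-- The number of sample points in `A`. -/
noncomputable def sampleCount (X : Fin n → Ω → E) (A : Set E) (ω : Ω) : ℝ :=
  ∑ i, A.indicator 1 (X i ω)

lemma maxDeviation_nonneg (X : Fin n → Ω → E) (μ : Measure E) (A : Set E) (ω : Ω) :
    0 ≤ maxDeviation X μ A ω := runMax_nonneg _ _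

lemma indicator_one_nonneg (A : Set E) (x : E) : (0 : ℝ) ≤ A.indicator 1 x :=
  Set.indicator_nonneg (fun _ _ => zero_le_one) x

lemma indicator_one_le_one (A : Set E) (x : E) : A.indicator (1 : E → ℝ) x ≤ 1 :=
  Set.indicator_le_self' (fun _ _ => zero_le_one) x

variable {P : Measure Ω} {μ : Measure E} [IsProbabilityMeasure μ] {X : Fin n → Ω → E}

lemma abs_centredIndicator_le_one (A : Set E) (k : ℕ) (ω : Ω) :
    |centredIndicator X μ A k ω| ≤ 1 := by
  unfold centredIndicator
  split_ifs with h
  · have h1 := indicator_one_nonneg A (X ⟨k, h⟩ ω)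
    have h2 := indicator_one_le_one A (X ⟨k, h⟩ ω)
    have h3 : 0 ≤ μ.real A := measureReal_nonneg
    have h4 : μ.real A ≤ 1 := measureReal_le_one
    rw [abs_le]
    constructor <;> linarith
  · simp

/-- A bound without cancellation, additive over disjoint sets. It serves for cells too fine for
Cauchy–Schwarz and for shells containing no sample point. -/
lemma maxDeviation_le (A : Set E) (ω : Ω) :
    maxDeviation X μ A ω ≤ sampleCount X A ω + n * μ.real A := by
  refine runMax_le fun k hk => (Finset.abs_sum_le_sum_abs _ _).trans ?_
  calc ∑ i ∈ Finset.range k, |centredIndicator X μ A i ω|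
      ≤ ∑ i ∈ Finset.range n, |centredIndicator X μ A i ω| :=
        Finset.sum_le_sum_of_subset_of_nonneg (Finset.range_mono hk) fun _ _ _ => abs_nonneg _
    _ = ∑ i : Fin n, |centredIndicator X μ A i ω| := Finset.sum_range _
    _ ≤ ∑ i : Fin n, (A.indicator 1 (X i ω) + μ.real A) := by
        refine Finset.sum_le_sum fun i _ => ?_
        simp only [centredIndicator, i.2, dite_true, Fin.eta]
        have h1 := indicator_one_nonneg A (X i ω)
        have h3 : 0 ≤ μ.real A := measureReal_nonneg
        rw [abs_le]
        constructor <;> linarith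
    _ = sampleCount X A ω + n * μ.real A := by
        rw [Finset.sum_add_distrib, sampleCount]
        simp

lemma sampleCount_le (A : Set E) (ω : Ω) :
    sampleCount X A ω ≤ maxDeviation X μ A ω + n * μ.real A := by
  have h := abs_le_runMax (fun k => ∑ i ∈ Finset.range k, centredIndicator X μ A i ω) (le_refl n)
  have h2 : ∑ i ∈ Finset.range n, centredIndicator X μ A i ω
      = sampleCount X A ω - n * μ.real A := by
    rw [Finset.sum_range]
    simp [centredIndicator, sampleCount]
  rw [h2] at h
  have := (le_abs_self _).trans h
  unfold maxDeviation
  linarith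

lemma measurable_indicator_comp {A : Set E} (hA : MeasurableSet A) {Y : Ω → E}
    (hY : Measurable Y) : Measurable fun ω => A.indicator (1 : E → ℝ) (Y ω) :=
  (measurable_one.indicator hA).comp hY

lemma measurable_centredIndicator (hX : ∀ i, Measurable (X i)) {A : Set E}
    (hA : MeasurableSet A) (k : ℕ) : Measurable (centredIndicator X μ A k) := by
  unfold centredIndicator
  split_ifs with h
  · exact (measurable_indicator_comp hA (hX _)).sub_const _
  · exact measurable_const

lemma measurable_maxDeviation (hX : ∀ i, Measurable (X i)) {A : Set E}
    (hA : MeasurableSet A) : Measurable (maxDeviation X μ A) :=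
  measurable_runMax fun _ _ => Finset.measurable_sum _ fun i _ =>
    measurable_centredIndicator hX hA i

lemma maxDeviation_le_two_mul (A : Set E) (ω : Ω) : maxDeviation X μ A ω ≤ 2 * n := by
  refine (maxDeviation_le A ω).trans ?_
  have h1 : sampleCount X A ω ≤ n := by
    refine (Finset.sum_le_sum fun i _ => indicator_one_le_one A (X i ω)).trans ?_
    simp
  have h2 : (n : ℝ) * μ.real A ≤ n * 1 := by
    gcongr
    exact measureReal_le_one
  linarith

/-- The `σ`-algebra generated by the first `k` sample points. -/
abbrev pastSigma (X : Fin n → Ω → E) (k : ℕ) : MeasurableSpace Ω :=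
  ⨆ i ∈ {i : Fin n | (i : ℕ) < k}, MeasurableSpace.comap (X i) inferInstance

/-- Doob's inequality with the variance μ(A) - μ(A)² ≤ μ(A) of an indicator. Past the end of the
sample the increments are 0, which keeps them adapted. -/
lemma integral_maxDeviation_sq_le [IsProbabilityMeasure P] (hX : ∀ i, Measurable (X i))
    (hind : iIndepFun X P) (hlaw : ∀ i, P.map (X i) = μ) {A : Set E} (hA : MeasurableSet A) :
    ∫ ω, maxDeviation X μ A ω ^ 2 ∂P ≤ 4 * (n * μ.real A) := by
  have hmean : ∀ i, ∫ ω, A.indicator (1 : E → ℝ) (X i ω) ∂P = μ.real A := by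
    intro i
    rw [← hlaw i, ← integral_map (hX i).aemeasurable
      (measurable_one.indicator hA).aestronglyMeasurable, integral_indicator_one hA]
  have hint : ∀ i, Integrable (fun ω => A.indicator (1 : E → ℝ) (X i ω)) P := fun i =>
    integrable_of_abs_le (c := 1) (measurable_indicator_comp hA (hX i)) fun ω => by
      rw [abs_of_nonneg (indicator_one_nonneg A _)]
      exact indicator_one_le_one A _
  have hcomap : ∀ (k : ℕ) (h : k < n),
      MeasurableSpace.comap (centredIndicator X μ A k) inferInstance
        ≤ MeasurableSpace.comap (X ⟨k, h⟩) inferInstance := by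
    intro k h
    refine Measurable.comap_le ?_
    have : centredIndicator X μ A k
        = (fun x => A.indicator (1 : E → ℝ) x - μ.real A) ∘ X ⟨k, h⟩ := by
      ext ω
      simp [centredIndicator, h]
    rw [this]
    exact ((measurable_one.indicator hA).sub_const _).comp (comap_measurable _)
  refine integral_runMax_sq_le (ℱ := pastSigma X) (fun k => iSup₂_le fun i _ => (hX i).comap_le)
    (fun j k hjk => biSup_mono fun i (hi : (i : ℕ) < j) => hi.trans_le hjk) (fun k => ?_)
    (abs_centredIndicator_le_one A) (fun k hk => ?_) (fun k hk => ?_) (fun k hk => ?_)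
  · by_cases h : k < n
    · refine measurable_iff_comap_le.2 ((hcomap k h).trans ?_)
      exact le_iSup₂ (f := fun (i : Fin n) (_ : i ∈ {i : Fin n | (i : ℕ) < k + 1}) =>
        MeasurableSpace.comap (X i) inferInstance) ⟨k, h⟩ (Nat.lt_succ_self k)
    · have : centredIndicator X μ A k = fun _ => 0 := by
        ext ω
        simp [centredIndicator, h]
      rw [this]
      exact measurable_const
  -- The k-th point and the earlier ones have disjoint index sets.
  · have h1 := indep_iSup_of_disjoint (m := fun i => MeasurableSpace.comap (X i) inferInstance)
      (fun i => (hX i).comap_le) hind (S := {⟨k, hk⟩}) (T := {i : Fin n | (i : ℕ) < k})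
      (by simp)
    rw [iSup_singleton] at h1
    exact indep_of_indep_of_le_left h1 (hcomap k hk)
  · simp only [centredIndicator, hk, dite_true]
    rw [integral_sub (hint _) (integrable_const _), hmean]
    simp
  · have h1 : ∀ ω, centredIndicator X μ A k ω ^ 2
        = (1 - 2 * μ.real A) * A.indicator 1 (X ⟨k, hk⟩ ω) + μ.real A ^ 2 := by
      intro ω
      simp only [centredIndicator, hk, dite_true]
      by_cases hω : X ⟨k, hk⟩ ω ∈ A
      · simp [hω]; ring
      · simp [hω]
    simp_rw [h1]
    rw [integral_add ((hint _).const_mul _) (integrable_const _), integral_const_mul, hmean]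
    simp only [integral_const, probReal_univ, smul_eq_mul, one_mul]
    nlinarith [sq_nonneg (μ.real A)]

end Deviation

/-! ### From empirical measures to maximal deviations -/

section EmpiricalDeviation

variable {d n : ℕ} {Ω : Type*} {μ : Measure (EuclideanSpace ℝ (Fin d))} [IsProbabilityMeasure μ]
  {X : Fin n → Ω → EuclideanSpace ℝ (Fin d)}

lemma empirical_apply {k : ℕ} (y : Fin k → EuclideanSpace ℝ (Fin d))
    {A : Set (EuclideanSpace ℝ (Fin d))} (hA : MeasurableSet A) :
    empirical y A = (k : ℝ≥0∞)⁻¹ * ENNReal.ofReal (∑ i, A.indicator 1 (y i)) := by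
  rw [empirical, Measure.smul_apply, Measure.finsetSum_apply, smul_eq_mul,
    ENNReal.ofReal_sum_of_nonneg fun i _ => indicator_one_nonneg A _]
  congr 1
  refine Finset.sum_congr rfl fun i _ => ?_
  rw [Measure.dirac_apply' _ hA]
  by_cases h : y i ∈ A <;> simp [h]

lemma isProbabilityMeasure_empirical {k : ℕ} (hk : 1 ≤ k)
    (y : Fin k → EuclideanSpace ℝ (Fin d)) : IsProbabilityMeasure (empirical y) := by
  constructor
  rw [empirical_apply y MeasurableSet.univ]
  simp only [Set.indicator_univ, Pi.one_apply, Finset.sum_const, Finset.card_univ,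
    Fintype.card_fin, nsmul_eq_mul, mul_one, ENNReal.ofReal_natCast]
  exact ENNReal.inv_mul_cancel (by positivity) (by simp)

/-- The two truncated differences add up to |μ_k(A) - μ(A)|, and k times this is the absolute value
of the k-th centred partial sum. -/
lemma mul_empirical_sub_le {k : ℕ} (hk : k ∈ Set.Icc 1 n)
    {A : Set (EuclideanSpace ℝ (Fin d))} (hA : MeasurableSet A) (ω : Ω) :
    (k : ℝ≥0∞) * ((empirical (fun i : Fin k => X (i.castLE hk.2) ω) A - μ A)
        + (μ A - empirical (fun i : Fin k => X (i.castLE hk.2) ω) A))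
      ≤ ENNReal.ofReal (maxDeviation X μ A ω) := by
  have hk0 : (k : ℝ≥0∞) ≠ 0 := by
    have := hk.1
    positivity
  set a : ℝ := ∑ i : Fin k, A.indicator 1 (X (i.castLE hk.2) ω) with ha
  have ha0 : 0 ≤ a := Finset.sum_nonneg fun i _ => indicator_one_nonneg A _
  set b : ℝ := k * μ.real A with hb
  have hb0 : 0 ≤ b := by positivity
  have h1 : (k : ℝ≥0∞) * empirical (fun i : Fin k => X (i.castLE hk.2) ω) A
      = ENNReal.ofReal a := by
    rw [empirical_apply _ hA, ← mul_assoc, ENNReal.mul_inv_cancel hk0 (by simp), one_mul]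
  have h2 : (k : ℝ≥0∞) * μ A = ENNReal.ofReal b := by
    rw [hb, ENNReal.ofReal_mul (Nat.cast_nonneg k), ENNReal.ofReal_natCast, ofReal_measureReal]
  have h3 : ∑ i ∈ Finset.range k, centredIndicator X μ A i ω = a - b := by
    rw [Finset.sum_range]
    have : ∀ i : Fin k, centredIndicator X μ A i ω
        = A.indicator 1 (X (i.castLE hk.2) ω) - μ.real A := by
      intro i
      have hi : (i : ℕ) < n := i.2.trans_le hk.2
      simp only [centredIndicator, hi, dite_true]
      rfl
    simp_rw [this]
    rw [Finset.sum_sub_distrib, ha, hb]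
    simp
  have h4 : |a - b| ≤ maxDeviation X μ A ω := by
    rw [← h3]
    exact abs_le_runMax (fun k => ∑ i ∈ Finset.range k, centredIndicator X μ A i ω) hk.2
  rw [mul_add, ENNReal.mul_sub fun _ _ => by simp, ENNReal.mul_sub fun _ _ => by simp, h1, h2,
    ← ENNReal.ofReal_sub _ hb0, ← ENNReal.ofReal_sub _ ha0]
  rcases le_total a b with h | h
  · rw [ENNReal.ofReal_of_nonpos (by linarith), zero_add]
    refine ENNReal.ofReal_le_ofReal (le_trans ?_ h4)
    rw [abs_sub_comm]
    exact le_abs_self _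
  · rw [ENNReal.ofReal_of_nonpos (by linarith : b - a ≤ 0), add_zero]
    exact ENNReal.ofReal_le_ofReal ((le_abs_self _).trans h4)

/-- All the rescaled transport costs up to time `n` are dominated by one multiscale sum of maximal
deviations. -/
lemma mul_wassersteinPow_le {p s : ℝ} (hp : 1 ≤ p) (hs : 0 < s)
    (hμ : ∫⁻ y, ENNReal.ofReal ((s * 2 ^ shell s y) ^ p) ∂μ ≠ ∞) (ω : Ω) :
    (⨆ (k : ℕ) (hk : k ∈ Set.Icc 1 n),
      (k : ℝ≥0∞) * wassersteinPow p (empirical fun i : Fin k => X (i.castLE hk.2) ω) μ)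
    ≤ ENNReal.ofReal ((4 * d) ^ p) *
        multiscaleSum p s fun A => ENNReal.ofReal (maxDeviation X μ A ω) := by
  refine iSup₂_le fun k hk => ?_
  have := isProbabilityMeasure_empirical hk.1 fun i : Fin k => X (i.castLE hk.2) ω
  refine (mul_le_mul_right (wassersteinPow_le_multiscaleSum hp hs _ μ hμ) _).trans ?_
  rw [mul_left_comm]
  gcongr
  rw [multiscaleSum, multiscaleSum, ← ENNReal.tsum_mul_left]
  refine ENNReal.tsum_le_tsum fun l => ?_
  rw [mul_left_comm]
  gcongr
  rw [← ENNReal.tsum_mul_left]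
  refine ENNReal.tsum_le_tsum fun i => ?_
  rw [mul_left_comm]
  gcongr
  exact mul_empirical_sub_le hk (measurable_cellLabel s l (measurableSet_singleton i)) ω

end EmpiricalDeviation

/-! ### Second moments of the deviations summed over one shell -/

section ShellDeviation

variable {d n : ℕ} {Ω : Type*} [MeasurableSpace Ω] {P : Measure Ω} [IsProbabilityMeasure P]
  {μ : Measure (EuclideanSpace ℝ (Fin d))} [IsProbabilityMeasure μ]
  {X : Fin n → Ω → EuclideanSpace ℝ (Fin d)}

/-- The sum of the maximal deviations over the cells of level `l` in the shell `m`. -/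
noncomputable def shellDeviation (X : Fin n → Ω → EuclideanSpace ℝ (Fin d))
    (μ : Measure (EuclideanSpace ℝ (Fin d))) (s : ℝ) (m l : ℕ) (ω : Ω) : ℝ :=
  ∑ F ∈ labelBox d l, maxDeviation X μ (cellLabel s l ⁻¹' {(m, F)}) ω

lemma shellDeviation_nonneg (s : ℝ) (m l : ℕ) (ω : Ω) : 0 ≤ shellDeviation X μ s m l ω :=
  Finset.sum_nonneg fun _ _ => maxDeviation_nonneg _ _ _ _

lemma measurableSet_cell (s : ℝ) (l : ℕ) (i : ℕ × (Fin d → ℤ)) :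
    MeasurableSet (cellLabel s l ⁻¹' {i} : Set (EuclideanSpace ℝ (Fin d))) :=
  measurable_cellLabel s l (measurableSet_singleton i)

lemma measurableSet_shell (s : ℝ) (m : ℕ) :
    MeasurableSet (shell s ⁻¹' {m} : Set (EuclideanSpace ℝ (Fin d))) :=
  measurable_shell s (measurableSet_singleton m)

lemma measurable_shellDeviation (hX : ∀ i, Measurable (X i)) (s : ℝ) (m l : ℕ) :
    Measurable (shellDeviation X μ s m l) :=
  Finset.measurable_sum _ fun _ _ => measurable_maxDeviation hX (measurableSet_cell s l _)

lemma sum_indicator_cell_le (s : ℝ) (m l : ℕ) (x : EuclideanSpace ℝ (Fin d)) :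
    ∑ F ∈ labelBox d l, (cellLabel s l ⁻¹' {(m, F)}).indicator (1 : EuclideanSpace ℝ (Fin d) → ℝ) x
      ≤ (shell s ⁻¹' {m}).indicator 1 x := by
  classical
  have h1 : ∀ F ∈ labelBox d l, (cellLabel s l ⁻¹' {(m, F)}).indicator (1 : EuclideanSpace ℝ (Fin d) → ℝ) x
      ≤ if F = (cellLabel s l x).2 then (shell s ⁻¹' {m}).indicator 1 x else 0 := by
    intro F _
    by_cases hx : x ∈ cellLabel s l ⁻¹' {(m, F)}
    · have h2 : cellLabel s l x = (m, F) := hx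
      have h3 : x ∈ shell s ⁻¹' {m} := shell_eq_of_cell hx
      rw [Set.indicator_of_mem hx, if_pos (by rw [h2]), Set.indicator_of_mem h3]
    · rw [Set.indicator_of_notMem hx]
      split_ifs
      · exact indicator_one_nonneg _ _
      · exact le_rfl
  refine (Finset.sum_le_sum h1).trans ?_
  rw [Finset.sum_ite_eq']
  split_ifs
  · exact le_rfl
  · exact indicator_one_nonneg _ _

lemma sum_measureReal_cell_le (s : ℝ) (m l : ℕ) :
    ∑ F ∈ labelBox d l, μ.real (cellLabel s l ⁻¹' {(m, F)}) ≤ μ.real (shell s ⁻¹' {m}) := by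
  rw [← measureReal_biUnion_finset]
  · refine measureReal_mono (Set.iUnion₂_subset fun F _ y hy => ?_)
    exact shell_eq_of_cell hy
  · intro F _ G _ hFG
    refine Set.disjoint_left.2 fun y hy hy' => hFG ?_
    have h1 : cellLabel s l y = (m, F) := hy
    have h2 : cellLabel s l y = (m, G) := hy'
    exact (Prod.mk.inj (h1.symm.trans h2)).2
  · exact fun F _ => measurableSet_cell s l _

lemma shellDeviation_le (s : ℝ) (m l : ℕ) (ω : Ω) :
    shellDeviation X μ s m l ω
      ≤ sampleCount X (shell s ⁻¹' {m}) ω + n * μ.real (shell s ⁻¹' {m}) := by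
  refine (Finset.sum_le_sum fun F _ => maxDeviation_le _ ω).trans ?_
  rw [Finset.sum_add_distrib, ← Finset.mul_sum]
  refine add_le_add ?_ ?_
  · unfold sampleCount
    rw [Finset.sum_comm]
    exact Finset.sum_le_sum fun i _ => sum_indicator_cell_le s m l _
  · gcongr
    exact sum_measureReal_cell_le s m l

/-- Two bounds compete. For coarse cells, Cauchy–Schwarz over at most 4^d 2^(dl) of them; for fine
cells, the sum is at most the deviation D of the whole shell plus 2a, whose square is at most 2D² +
8a², of mean at most 8a(1 + a), uniformly in l. -/
lemma integral_shellDeviation_sq_le (hX : ∀ i, Measurable (X i))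
    (hind : iIndepFun X P) (hlaw : ∀ i, P.map (X i) = μ) (s : ℝ) (m l : ℕ) :
    ∫ ω, shellDeviation X μ s m l ω ^ 2 ∂P ≤ 8 * 4 ^ d * (n * μ.real (shell s ⁻¹' {m}))
      * min (2 ^ (d * l)) (1 + n * μ.real (shell s ⁻¹' {m})) := by
  set a : ℝ := n * μ.real (shell s ⁻¹' {m}) with ha
  have ha0 : 0 ≤ a := by positivity
  have hsqi : ∀ A : Set (EuclideanSpace ℝ (Fin d)), MeasurableSet A →
      Integrable (fun ω => maxDeviation X μ A ω ^ 2) P := fun A hA =>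
    integrable_of_abs_le (c := (2 * n : ℝ) ^ 2) ((measurable_maxDeviation hX hA).pow_const 2)
      fun ω => by
        rw [abs_pow, abs_of_nonneg (maxDeviation_nonneg X μ A ω)]
        exact pow_le_pow_left₀ (maxDeviation_nonneg X μ A ω) (maxDeviation_le_two_mul A ω) 2
  have hcard : ((labelBox d l).card : ℝ) ≤ 4 ^ d * 2 ^ (d * l) := by
    exact_mod_cast card_labelBox_le d l
  have hpt1 : ∀ ω, shellDeviation X μ s m l ω ^ 2 ≤ (4 ^ d * 2 ^ (d * l)) *
      ∑ F ∈ labelBox d l, maxDeviation X μ (cellLabel s l ⁻¹' {(m, F)}) ω ^ 2 := by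
    intro ω
    refine sq_sum_le_card_mul_sum_sq.trans ?_
    exact mul_le_mul_of_nonneg_right hcard (Finset.sum_nonneg fun _ _ => sq_nonneg _)
  have hi1 : Integrable (fun ω => (4 ^ d * 2 ^ (d * l) : ℝ) *
      ∑ F ∈ labelBox d l, maxDeviation X μ (cellLabel s l ⁻¹' {(m, F)}) ω ^ 2) P :=
    (integrable_finsetSum _ fun F _ => hsqi _ (measurableSet_cell s l _)).const_mul _
  have hZi : Integrable (fun ω => shellDeviation X μ s m l ω ^ 2) P :=
    hi1.mono' ((measurable_shellDeviation hX s m l).pow_const 2).aestronglyMeasurable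
      (.of_forall fun ω => by
        rw [Real.norm_of_nonneg (sq_nonneg _)]
        exact hpt1 ω)
  have hb1 : ∫ ω, shellDeviation X μ s m l ω ^ 2 ∂P ≤ (4 ^ d * 2 ^ (d * l)) * (4 * a) := by
    refine (integral_mono hZi hi1 hpt1).trans ?_
    rw [integral_const_mul, integral_finsetSum _ fun F _ => hsqi _ (measurableSet_cell s l _)]
    gcongr
    refine (Finset.sum_le_sum fun F _ =>
      integral_maxDeviation_sq_le (P := P) hX hind hlaw (measurableSet_cell s l (m, F))).trans ?_
    rw [← Finset.mul_sum, ← Finset.mul_sum, ha]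
    have := sum_measureReal_cell_le (μ := μ) s m l
    gcongr
  have hpt2 : ∀ ω, shellDeviation X μ s m l ω ^ 2
      ≤ 2 * maxDeviation X μ (shell s ⁻¹' {m}) ω ^ 2 + 8 * a ^ 2 := by
    intro ω
    have h1 := shellDeviation_le (X := X) (μ := μ) s m l ω
    have h2 := sampleCount_le (X := X) (μ := μ) (shell s ⁻¹' {m}) ω
    have h3 : shellDeviation X μ s m l ω
        ≤ maxDeviation X μ (shell s ⁻¹' {m}) ω + 2 * a := by linarith
    have h4 := pow_le_pow_left₀ (shellDeviation_nonneg s m l ω) h3 2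
    nlinarith [sq_nonneg (maxDeviation X μ (shell s ⁻¹' {m}) ω - 2 * a)]
  have hi2 : Integrable (fun ω => 2 * maxDeviation X μ (shell s ⁻¹' {m}) ω ^ 2 + 8 * a ^ 2) P :=
    ((hsqi _ (measurableSet_shell s m)).const_mul 2).add (integrable_const _)
  have hb2 : ∫ ω, shellDeviation X μ s m l ω ^ 2 ∂P ≤ 8 * a * (1 + a) := by
    refine (integral_mono hZi hi2 hpt2).trans ?_
    rw [integral_add ((hsqi _ (measurableSet_shell s m)).const_mul 2) (integrable_const _),
      integral_const_mul]
    have := integral_maxDeviation_sq_le hX hind hlaw (measurableSet_shell (d := d) s m)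
    simp only [integral_const, probReal_univ, smul_eq_mul, one_mul]
    nlinarith
  have h4d : (1 : ℝ) ≤ 4 ^ d := one_le_pow₀ (by norm_num)
  rcases le_total ((2 : ℝ) ^ (d * l)) (1 + a) with h | h
  · rw [min_eq_left h]
    refine hb1.trans ?_
    have : (0 : ℝ) ≤ 4 ^ d * 2 ^ (d * l) * a := by positivity
    linarith
  · rw [min_eq_right h]
    refine hb2.trans ?_
    have : 0 ≤ 8 * a * (1 + a) := by positivity
    nlinarith

/-- Labels outside the finite box belong to empty cells, whose deviation is 0; the remaining sums
are regrouped by shells. -/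
lemma multiscaleSum_maxDeviation {p s : ℝ} (hs : 0 < s) (ω : Ω) :
    (multiscaleSum p s fun A => ENNReal.ofReal (maxDeviation X μ A ω))
      = ∑' m : ℕ, ENNReal.ofReal ((s * 2 ^ m) ^ p) *
        ∑' l : ℕ, ENNReal.ofReal (2 ^ (-(p * l))) *
          ENNReal.ofReal (shellDeviation X μ s m l ω) := by
  have h1 : ∀ l m : ℕ, ∑' F : Fin d → ℤ,
      ENNReal.ofReal (maxDeviation X μ (cellLabel s l ⁻¹' {(m, F)}) ω)
      = ENNReal.ofReal (shellDeviation X μ s m l ω) := by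
    intro l m
    rw [shellDeviation, ENNReal.ofReal_sum_of_nonneg fun _ _ => maxDeviation_nonneg _ _ _ _]
    refine tsum_eq_sum fun F hF => ?_
    rw [cell_eq_empty hs hF]
    refine ENNReal.ofReal_of_nonpos ((maxDeviation_le _ ω).trans ?_)
    simp [sampleCount]
  have h2 : ∀ l : ℕ, ∑' i : ℕ × (Fin d → ℤ), ENNReal.ofReal ((s * 2 ^ i.1) ^ p) *
      ENNReal.ofReal (maxDeviation X μ (cellLabel s l ⁻¹' {i}) ω)
      = ∑' m : ℕ, ENNReal.ofReal ((s * 2 ^ m) ^ p) *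
        ENNReal.ofReal (shellDeviation X μ s m l ω) := by
    intro l
    rw [ENNReal.tsum_prod']
    refine tsum_congr fun m => ?_
    rw [← h1, ← ENNReal.tsum_mul_left]
  rw [multiscaleSum]
  simp_rw [h2, ← ENNReal.tsum_mul_left]
  rw [ENNReal.tsum_comm]
  refine tsum_congr fun m => tsum_congr fun l => ?_
  ring

end ShellDeviation

/-! ### The L² norm on `[0, ∞]`-valued functions: Minkowski and Chebyshev -/

section L2

variable {Ω : Type*} [MeasurableSpace Ω] {P : Measure Ω}

/-- The `L²` norm of a function with values in `[0, ∞]`. -/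
noncomputable def l2norm (P : Measure Ω) (f : Ω → ℝ≥0∞) : ℝ≥0∞ :=
  (∫⁻ ω, f ω ^ (2 : ℝ) ∂P) ^ (1 / 2 : ℝ)

lemma l2norm_const_mul {f : Ω → ℝ≥0∞} (hf : Measurable f) (c : ℝ≥0∞) :
    l2norm P (fun ω => c * f ω) = c * l2norm P f := by
  unfold l2norm
  simp_rw [ENNReal.mul_rpow_of_nonneg _ _ (by norm_num : (0 : ℝ) ≤ 2)]
  rw [lintegral_const_mul _ (hf.pow_const 2),
    ENNReal.mul_rpow_of_nonneg _ _ (by norm_num : (0 : ℝ) ≤ 1 / 2), ← ENNReal.rpow_mul]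
  norm_num

lemma l2norm_sum_le {ι : Type*} (t : Finset ι) {f : ι → Ω → ℝ≥0∞} (hf : ∀ i, Measurable (f i)) :
    l2norm P (fun ω => ∑ i ∈ t, f i ω) ≤ ∑ i ∈ t, l2norm P (f i) := by
  classical
  induction t using Finset.induction_on with
  | empty => simp [l2norm]
  | insert i t hi ih =>
    simp_rw [Finset.sum_insert hi]
    refine le_trans ?_ (add_le_add le_rfl ih)
    exact ENNReal.lintegral_Lp_add_le (hf i).aemeasurable
      (Finset.measurable_fun_sum t fun j _ => hf j).aemeasurable (by norm_num)

lemma l2norm_tsum_le {f : ℕ → Ω → ℝ≥0∞} (hf : ∀ i, Measurable (f i)) :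
    l2norm P (fun ω => ∑' i, f i ω) ≤ ∑' i, l2norm P (f i) := by
  have h1 : ∀ ω, (∑' i, f i ω) ^ (2 : ℝ) = ⨆ N, (∑ i ∈ Finset.range N, f i ω) ^ (2 : ℝ) := by
    intro ω
    rw [ENNReal.tsum_eq_iSup_nat]
    exact (ENNReal.orderIsoRpow 2 (by norm_num)).map_iSup _
  unfold l2norm
  simp_rw [h1]
  rw [lintegral_iSup (fun N => (Finset.measurable_fun_sum _ fun j _ => hf j).pow_const 2)
    (fun N N' h ω => ENNReal.rpow_le_rpow
      (Finset.sum_le_sum_of_subset (Finset.range_mono h)) (by norm_num))]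
  rw [show (⨆ N, ∫⁻ ω, (∑ i ∈ Finset.range N, f i ω) ^ (2 : ℝ) ∂P) ^ (1 / 2 : ℝ)
    = ⨆ N, (∫⁻ ω, (∑ i ∈ Finset.range N, f i ω) ^ (2 : ℝ) ∂P) ^ (1 / 2 : ℝ) from
    (ENNReal.orderIsoRpow (1 / 2) (by norm_num)).map_iSup _]
  exact iSup_le fun N => (l2norm_sum_le (Finset.range N) hf).trans (ENNReal.sum_le_tsum _)

lemma measure_lt_le_l2norm {f : Ω → ℝ≥0∞} (hf : Measurable f) {t c : ℝ} (ht : 0 < t)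
    (hc : 0 ≤ c) (h : l2norm P f ≤ ENNReal.ofReal c) :
    P {ω | ENNReal.ofReal t < f ω} ≤ ENNReal.ofReal ((c / t) ^ 2) := by
  have h1 : ∫⁻ ω, f ω ^ (2 : ℝ) ∂P ≤ ENNReal.ofReal (c ^ 2) := by
    have := ENNReal.rpow_le_rpow h (by norm_num : (0 : ℝ) ≤ 2)
    rw [l2norm, ← ENNReal.rpow_mul, ENNReal.ofReal_rpow_of_nonneg hc (by norm_num)] at this
    norm_num at this
    simpa using this
  have h2 : {ω | ENNReal.ofReal t < f ω} ⊆ {ω | ENNReal.ofReal (t ^ 2) ≤ f ω ^ (2 : ℝ)} := by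
    intro ω (hω : ENNReal.ofReal t < f ω)
    have := ENNReal.rpow_le_rpow hω.le (by norm_num : (0 : ℝ) ≤ 2)
    rw [ENNReal.ofReal_rpow_of_nonneg ht.le (by norm_num)] at this
    simpa using this
  refine (measure_mono h2).trans ((meas_ge_le_lintegral_div (hf.pow_const 2).aemeasurable
    (by rw [ne_eq, ENNReal.ofReal_eq_zero, not_le]; positivity) ENNReal.ofReal_ne_top).trans ?_)
  rw [div_pow, ENNReal.ofReal_div_of_pos (by positivity)]
  gcongr

lemma l2norm_ofReal_le {f : Ω → ℝ} (hf0 : ∀ ω, 0 ≤ f ω)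
    (hint : Integrable (fun ω => f ω ^ 2) P) {c : ℝ} (hc : 0 ≤ c) (h : ∫ ω, f ω ^ 2 ∂P ≤ c ^ 2) :
    l2norm P (fun ω => ENNReal.ofReal (f ω)) ≤ ENNReal.ofReal c := by
  unfold l2norm
  have h1 : ∀ ω, ENNReal.ofReal (f ω) ^ (2 : ℝ) = ENNReal.ofReal (f ω ^ 2) := by
    intro ω
    rw [ENNReal.ofReal_rpow_of_nonneg (hf0 ω) (by norm_num)]
    simp
  simp_rw [h1]
  rw [← ofReal_integral_eq_lintegral_ofReal hint (.of_forall fun ω => sq_nonneg _)]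
  calc ENNReal.ofReal (∫ ω, f ω ^ 2 ∂P) ^ (1 / 2 : ℝ) ≤ ENNReal.ofReal (c ^ 2) ^ (1 / 2 : ℝ) := by
        gcongr
    _ = ENNReal.ofReal c := by
        rw [ENNReal.ofReal_rpow_of_nonneg (by positivity) (by norm_num), ← Real.sqrt_eq_rpow,
          Real.sqrt_sq hc]

end L2

/-! ### Geometric sums and the sum over the levels of a shell -/

section Geometric

lemma two_rpow_neg_lt_one {e : ℝ} (he : 0 < e) : (2 : ℝ) ^ (-e) < 1 :=
  Real.rpow_lt_one_of_one_lt_of_neg (by norm_num) (by linarith)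

/-- The sum `∑ 2^(-e m)` over all `m ≥ 0`. -/
noncomputable def geomConst (e : ℝ) : ℝ := (1 - (2 : ℝ) ^ (-e))⁻¹

lemma geomConst_pos {e : ℝ} (he : 0 < e) : 0 < geomConst e :=
  inv_pos.2 (sub_pos.2 (two_rpow_neg_lt_one he))

lemma geomConst_eq {e : ℝ} (he : 0 < e) : 2 ^ (-e) * geomConst e + 1 = geomConst e := by
  have : 1 - (2 : ℝ) ^ (-e) ≠ 0 := (sub_pos.2 (two_rpow_neg_lt_one he)).ne'
  unfold geomConst
  field_simp
  ring

/-- The sum `∑ 2^(e m)` over `m ≤ M`. -/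
noncomputable def geomSum (e : ℝ) (M : ℕ) : ℝ := ∑ m ∈ Finset.range (M + 1), (2 : ℝ) ^ (e * m)

lemma geomSum_nonneg (e : ℝ) (M : ℕ) : 0 ≤ geomSum e M :=
  Finset.sum_nonneg fun _ _ => by positivity

lemma geomSum_le_of_pos {e : ℝ} (he : 0 < e) (M : ℕ) :
    geomSum e M ≤ 2 ^ (e * M) * geomConst e := by
  unfold geomSum
  induction M with
  | zero =>
    have h1 := geomConst_eq he
    have h2 : 0 ≤ 2 ^ (-e) * geomConst e := mul_nonneg (by positivity) (geomConst_pos he).le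
    simp
    linarith
  | succ M ih =>
    rw [Finset.sum_range_succ]
    refine (add_le_add ih le_rfl).trans (le_of_eq ?_)
    have : (2 : ℝ) ^ (e * M) = 2 ^ (e * (M + 1 : ℕ)) * 2 ^ (-e) := by
      rw [← Real.rpow_add (by norm_num)]
      congr 1
      push_cast
      ring
    rw [this]
    linear_combination (2 : ℝ) ^ (e * (M + 1 : ℕ)) * geomConst_eq he

lemma hasSum_geom {e : ℝ} (he : 0 < e) (K : ℝ) :
    HasSum (fun m : ℕ => K * (2 : ℝ) ^ (-(e * m))) (K * geomConst e) := by
  have h : ∀ m : ℕ, (2 : ℝ) ^ (-(e * m)) = (2 ^ (-e)) ^ m := by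
    intro m
    rw [← Real.rpow_natCast, ← Real.rpow_mul (by norm_num), neg_mul]
  simp_rw [h]
  exact (hasSum_geometric_of_lt_one (by positivity) (two_rpow_neg_lt_one he)).mul_left K

lemma tsum_ofReal_geom {e : ℝ} (he : 0 < e) {K : ℝ} (hK : 0 ≤ K) :
    ∑' m : ℕ, ENNReal.ofReal (K * 2 ^ (-(e * m))) = ENNReal.ofReal (K * geomConst e) := by
  rw [← (hasSum_geom he K).tsum_eq,
    ENNReal.ofReal_tsum_of_nonneg (fun _ => by positivity) (hasSum_geom he K).summable]

lemma geomSum_le_of_neg {e : ℝ} (he : e < 0) (M : ℕ) : geomSum e M ≤ geomConst (-e) := by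
  have h := hasSum_geom (neg_pos.2 he) 1
  simp only [one_mul, neg_mul, neg_neg] at h
  exact sum_le_hasSum _ (fun _ _ => by positivity) h

lemma geomSum_zero (M : ℕ) : geomSum 0 M = M + 1 := by simp [geomSum]

/-- The sum over the levels of a shell, subcritical exponent. -/
lemma exists_levelSum_le_of_lt {p D θ : ℝ} (hθ : θ ∈ Set.Icc (0 : ℝ) 1) (h : D * (1 - θ) < p) :
    ∃ C : ℝ, 0 < C ∧ ∀ b : ℝ, 1 ≤ b →
      ∑' l : ℕ, ENNReal.ofReal (2 ^ (-(p * l)) * min (2 ^ (D * l)) b)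
        ≤ ENNReal.ofReal (C * b ^ θ) := by
  have he : 0 < p - D * (1 - θ) := by linarith
  refine ⟨geomConst (p - D * (1 - θ)), geomConst_pos he, fun b hb => ?_⟩
  have hb0 : 0 < b := by linarith
  rw [mul_comm, ← tsum_ofReal_geom he (by positivity)]
  refine ENNReal.tsum_le_tsum fun l => ENNReal.ofReal_le_ofReal ?_
  set x : ℝ := 2 ^ (D * l) with hx
  have hx0 : 0 < x := by positivity
  -- Interpolating the minimum leaves the geometric decay p - D(1 - θ) > 0.
  have hmin : min x b ≤ x ^ (1 - θ) * b ^ θ := by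
    have h0 : 0 < min x b := lt_min hx0 hb0
    calc min x b = (min x b) ^ (1 - θ) * (min x b) ^ θ := by
          rw [← Real.rpow_add h0]; simp
      _ ≤ x ^ (1 - θ) * b ^ θ := by
          have h1 : (min x b) ^ (1 - θ) ≤ x ^ (1 - θ) :=
            Real.rpow_le_rpow h0.le (min_le_left _ _) (by linarith [hθ.2])
          have h2 : (min x b) ^ θ ≤ b ^ θ :=
            Real.rpow_le_rpow h0.le (min_le_right _ _) hθ.1
          exact mul_le_mul h1 h2 (by positivity) (by positivity)
  calc 2 ^ (-(p * l)) * min x b ≤ 2 ^ (-(p * l)) * (x ^ (1 - θ) * b ^ θ) := by gcongr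
    _ = b ^ θ * 2 ^ (-((p - D * (1 - θ)) * l)) := by
        rw [hx, ← Real.rpow_mul (by norm_num), ← mul_assoc, ← Real.rpow_add (by norm_num), mul_comm]
        congr 2
        ring

/-- The sum over the levels of a shell, critical exponent. -/
lemma exists_levelSum_le_critical {p D : ℝ} (hp : 0 < p) (hD : p < D) :
    ∃ C : ℝ, 0 < C ∧ ∀ b : ℝ, 1 ≤ b →
      ∑' l : ℕ, ENNReal.ofReal (2 ^ (-(p * l)) * min (2 ^ (D * l)) b)
        ≤ ENNReal.ofReal (C * b ^ (1 - p / D)) := by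
  have hD0 : 0 < D := hp.trans hD
  have he : 0 < D - p := by linarith
  refine ⟨geomConst (D - p) + geomConst p, add_pos (geomConst_pos he) (geomConst_pos hp),
    fun b hb => ?_⟩
  have hb0 : 0 < b := by linarith
  -- At θ = 1 - p/D interpolation would leave no decay. The sum is split instead at the level t
  -- where 2^(Dt) = b: it grows geometrically up to t and decays after it.
  set t : ℝ := Real.logb 2 b / D with ht
  have ht0 : 0 ≤ t := div_nonneg (Real.logb_nonneg (by norm_num) hb) hD0.le
  have hbt : b = 2 ^ (D * t) := by
    rw [ht, mul_div_cancel₀ _ hD0.ne', Real.rpow_logb (by norm_num) (by norm_num) hb0]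
  have hbθ : b ^ (1 - p / D) = 2 ^ ((D - p) * t) := by
    rw [hbt, ← Real.rpow_mul (by norm_num)]
    congr 1
    field_simp
  set N : ℕ := ⌊t⌋₊ with hN
  have hNt : (N : ℝ) ≤ t := Nat.floor_le ht0
  have htN : t < N + 1 := Nat.lt_floor_add_one t
  rw [← Summable.sum_add_tsum_nat_add' (k := N + 1) ENNReal.summable, add_mul,
    ENNReal.ofReal_add (by have := geomConst_pos he; positivity)
      (by have := geomConst_pos hp; positivity)]
  refine add_le_add ?_ ?_
  · rw [← ENNReal.ofReal_sum_of_nonneg fun _ _ => by positivity]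
    refine ENNReal.ofReal_le_ofReal ?_
    calc ∑ l ∈ Finset.range (N + 1), (2 : ℝ) ^ (-(p * l)) * min (2 ^ (D * l)) b
        ≤ geomSum (D - p) N := by
          refine Finset.sum_le_sum fun l _ => ?_
          calc (2 : ℝ) ^ (-(p * l)) * min (2 ^ (D * l)) b
              ≤ 2 ^ (-(p * l)) * 2 ^ (D * l) := by
                gcongr
                exact min_le_left _ _
            _ = 2 ^ ((D - p) * l) := by
                rw [← Real.rpow_add (by norm_num)]
                congr 1
                ring
      _ ≤ 2 ^ ((D - p) * N) * geomConst (D - p) := geomSum_le_of_pos he N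
      _ ≤ 2 ^ ((D - p) * t) * geomConst (D - p) := by
          have := geomConst_pos he
          gcongr
          norm_num
      _ = geomConst (D - p) * b ^ (1 - p / D) := by rw [hbθ, mul_comm]
  · rw [mul_comm, ← tsum_ofReal_geom hp (by positivity)]
    refine ENNReal.tsum_le_tsum fun l => ENNReal.ofReal_le_ofReal ?_
    calc (2 : ℝ) ^ (-(p * (l + (N + 1) : ℕ))) * min (2 ^ (D * (l + (N + 1) : ℕ))) b
        ≤ 2 ^ (-(p * (l + (N + 1) : ℕ))) * b := by
          gcongr
          exact min_le_right _ _
      _ = 2 ^ (D * t - p * (N + 1)) * 2 ^ (-(p * l)) := by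
          conv_lhs => rw [hbt]
          rw [← Real.rpow_add (by norm_num), ← Real.rpow_add (by norm_num)]
          congr 1
          push_cast
          ring
      _ ≤ b ^ (1 - p / D) * 2 ^ (-(p * l)) := by
          rw [hbθ]
          gcongr
          · norm_num
          · nlinarith

end Geometric

/-! ### L² bounds for the contribution of one shell -/

section Shells

variable {d n : ℕ} {Ω : Type*} [MeasurableSpace Ω] {P : Measure Ω} [IsProbabilityMeasure P]
  {μ : Measure (EuclideanSpace ℝ (Fin d))} [IsProbabilityMeasure μ]
  {X : Fin n → Ω → EuclideanSpace ℝ (Fin d)}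

/-- Shell m + 1 lies beyond radius s 2^m; the factor 2^q pays for this shift, and covers shell 0,
where the bound 1 is used. -/
lemma measureReal_shell_le {s q : ℝ} (hs : 0 < s) (hq : 0 ≤ q)
    (htail : ∀ t : ℝ, 0 < t →
      μ.real {y : EuclideanSpace ℝ (Fin d) | t < ‖y.ofLp‖} ≤ (s / t) ^ q) (m : ℕ) :
    μ.real (shell s ⁻¹' {m} : Set (EuclideanSpace ℝ (Fin d))) ≤ 2 ^ q * 2 ^ (-(q * m)) := by
  cases m with
  | zero =>
    refine measureReal_le_one.trans ?_
    simpa using Real.one_le_rpow (by norm_num : (1 : ℝ) ≤ 2) hq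
  | succ m =>
    calc μ.real (shell s ⁻¹' {m + 1} : Set (EuclideanSpace ℝ (Fin d)))
        ≤ μ.real {y : EuclideanSpace ℝ (Fin d) | s * 2 ^ m < ‖y.ofLp‖} := by
          refine measureReal_mono fun y (hy : shell s y = m + 1) => ?_
          exact lt_norm_of_lt_shell hs (by omega)
      _ ≤ (s / (s * 2 ^ m)) ^ q := htail _ (by positivity)
      _ = 2 ^ q * 2 ^ (-(q * (m + 1 : ℕ))) := by
          rw [div_mul_cancel_left₀ hs.ne', ← Real.rpow_natCast, ← Real.rpow_neg (by norm_num),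
            ← Real.rpow_mul (by norm_num), ← Real.rpow_add (by norm_num)]
          congr 1
          push_cast
          ring

lemma scale_rpow {s p : ℝ} (hs : 0 < s) (m : ℕ) :
    (s * 2 ^ m) ^ p = s ^ p * (2 : ℝ) ^ (p * m) := by
  rw [Real.mul_rpow hs.le (by positivity), ← Real.rpow_natCast 2 m, ← Real.rpow_mul (by norm_num),
    mul_comm (m : ℝ) p]

lemma lintegral_shell_ne_top {s p q : ℝ} (hs : 0 < s) (hq : 0 ≤ q) (hpq : p < q)
    (htail : ∀ t : ℝ, 0 < t →
      μ.real {y : EuclideanSpace ℝ (Fin d) | t < ‖y.ofLp‖} ≤ (s / t) ^ q) :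
    ∫⁻ y, ENNReal.ofReal ((s * 2 ^ shell s y) ^ p) ∂μ ≠ ∞ := by
  rw [lintegral_label (measurable_shell s) fun m => ENNReal.ofReal ((s * 2 ^ m) ^ p)]
  refine ne_top_of_le_ne_top (b := ENNReal.ofReal (s ^ p * 2 ^ q * geomConst (q - p)))
    ENNReal.ofReal_ne_top ?_
  rw [← tsum_ofReal_geom (by linarith) (by positivity)]
  refine ENNReal.tsum_le_tsum fun m => ?_
  rw [← ofReal_measureReal, ← ENNReal.ofReal_mul (by positivity)]
  refine ENNReal.ofReal_le_ofReal ?_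
  calc (s * 2 ^ m) ^ p * μ.real (shell s ⁻¹' {m})
      ≤ s ^ p * 2 ^ (p * m) * (2 ^ q * 2 ^ (-(q * m))) := by
        rw [scale_rpow hs]
        gcongr
        exact measureReal_shell_le hs hq htail m
    _ = s ^ p * 2 ^ q * 2 ^ (-((q - p) * m)) := by
        rw [show -((q - p) * (m : ℝ)) = p * m + -(q * m) by ring, Real.rpow_add (by norm_num)]
        ring

/-- The square root of `integral_shellDeviation_sq_le`, with 8 rounded up to 3² and 1 + a² ≤ (1 +
a)². -/
lemma l2norm_shellDeviation_le (hX : ∀ i, Measurable (X i))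
    (hind : iIndepFun X P) (hlaw : ∀ i, P.map (X i) = μ) {s : ℝ} {m l : ℕ} {a : ℝ} (ha : 0 ≤ a)
    (hm : n * μ.real (shell s ⁻¹' {m}) ≤ a ^ 2) :
    l2norm P (fun ω => ENNReal.ofReal (shellDeviation X μ s m l ω))
      ≤ ENNReal.ofReal (3 * 2 ^ d * a * min (2 ^ ((d / 2 : ℝ) * l)) (1 + a)) := by
  have hbd : ∀ ω, |shellDeviation X μ s m l ω| ≤ (labelBox d l).card * (2 * n) := by
    intro ω
    rw [abs_of_nonneg (shellDeviation_nonneg s m l ω)]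
    refine (Finset.sum_le_sum fun F _ => maxDeviation_le_two_mul _ ω).trans ?_
    simp
  refine l2norm_ofReal_le (shellDeviation_nonneg s m l)
    (integrable_of_abs_le (c := ((labelBox d l).card * (2 * n) : ℝ) ^ 2)
      ((measurable_shellDeviation hX s m l).pow_const 2) fun ω => by
        rw [abs_pow]
        exact pow_le_pow_left₀ (abs_nonneg _) (hbd ω) 2) (by positivity) ?_
  refine (integral_shellDeviation_sq_le hX hind hlaw s m l).trans ?_
  have h1 : (2 : ℝ) ^ (d * l) = (2 ^ ((d / 2 : ℝ) * l)) ^ 2 := by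
    rw [← Real.rpow_natCast, ← Real.rpow_natCast, ← Real.rpow_mul (by norm_num)]
    congr 1
    push_cast
    ring
  set x : ℝ := 2 ^ ((d / 2 : ℝ) * l) with hx
  have hx0 : 0 < x := by positivity
  set c : ℝ := n * μ.real (shell s ⁻¹' {m}) with hc
  have hc0 : 0 ≤ c := by positivity
  have h2 : min (2 ^ (d * l)) (1 + c) ≤ min x (1 + a) ^ 2 := by
    rw [h1]
    rcases le_total x (1 + a) with h | h
    · rw [min_eq_left h]
      exact min_le_left _ _
    · rw [min_eq_right h]
      refine (min_le_right _ _).trans ?_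
      nlinarith
  have h4 : (4 : ℝ) ^ d = (2 ^ d) ^ 2 := by
    rw [← pow_mul, mul_comm, pow_mul]; norm_num
  calc 8 * 4 ^ d * c * min (2 ^ (d * l)) (1 + c)
      ≤ 9 * 4 ^ d * a ^ 2 * min x (1 + a) ^ 2 := by
        have : 0 ≤ min (2 ^ (d * l)) (1 + c) := le_min (by positivity) (by positivity)
        gcongr
        norm_num
    _ = (3 * 2 ^ d * a * min x (1 + a)) ^ 2 := by rw [h4]; ring

/-- Separating the two powers of a turns the later sum over shells into two geometric sums. -/
lemma mul_one_add_rpow_le {a θ : ℝ} (ha : 0 < a) (hθ : θ ∈ Set.Icc (0 : ℝ) 1) :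
    a * (1 + a) ^ θ ≤ 2 * (a + a ^ (1 + θ)) := by
  have h1 : (1 + a) ^ θ ≤ 2 * (1 + a ^ θ) := by
    rcases le_total a 1 with h | h
    · calc (1 + a) ^ θ ≤ (2 : ℝ) ^ θ := Real.rpow_le_rpow (by linarith) (by linarith) hθ.1
        _ ≤ 2 ^ (1 : ℝ) := Real.rpow_le_rpow_of_exponent_le (by norm_num) hθ.2
        _ ≤ 2 * (1 + a ^ θ) := by
          have : 0 ≤ a ^ θ := by positivity
          rw [Real.rpow_one]; linarith
    · calc (1 + a) ^ θ ≤ (2 * a) ^ θ := Real.rpow_le_rpow (by linarith) (by linarith) hθ.1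
        _ = 2 ^ θ * a ^ θ := Real.mul_rpow (by norm_num) ha.le
        _ ≤ 2 ^ (1 : ℝ) * a ^ θ := by
          gcongr
          · norm_num
          · exact hθ.2
        _ ≤ 2 * (1 + a ^ θ) := by rw [Real.rpow_one]; linarith
  rw [Real.rpow_add ha, Real.rpow_one]
  nlinarith

lemma measurable_levelSum (hX : ∀ i, Measurable (X i)) (p s : ℝ) (m : ℕ) :
    Measurable fun ω => ∑' l : ℕ, ENNReal.ofReal (2 ^ (-(p * l))) *
      ENNReal.ofReal (shellDeviation X μ s m l ω) :=
  .tsum fun l => ((measurable_shellDeviation hX s m l).ennreal_ofReal).const_mul _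

/-- Minkowski over the levels, then `hlevel` at b = 1 + a. The level estimate is a hypothesis so
that both choices of θ are covered. -/
lemma l2norm_levelSum_le (hX : ∀ i, Measurable (X i))
    (hind : iIndepFun X P) (hlaw : ∀ i, P.map (X i) = μ) {p s θ C : ℝ} (hC : 0 < C)
    (hθ : θ ∈ Set.Icc (0 : ℝ) 1)
    (hlevel : ∀ b : ℝ, 1 ≤ b →
      ∑' l : ℕ, ENNReal.ofReal (2 ^ (-(p * l)) * min (2 ^ ((d / 2 : ℝ) * l)) b)
        ≤ ENNReal.ofReal (C * b ^ θ)) {m : ℕ} {a : ℝ} (ha : 0 < a)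
    (hm : n * μ.real (shell s ⁻¹' {m}) ≤ a ^ 2) :
    l2norm P (fun ω => ∑' l : ℕ, ENNReal.ofReal (2 ^ (-(p * l))) *
        ENNReal.ofReal (shellDeviation X μ s m l ω))
      ≤ ENNReal.ofReal (6 * 2 ^ d * C * (a + a ^ (1 + θ))) := by
  refine (l2norm_tsum_le fun l =>
    ((measurable_shellDeviation hX s m l).ennreal_ofReal).const_mul _).trans ?_
  calc ∑' l : ℕ, l2norm P (fun ω => ENNReal.ofReal (2 ^ (-(p * l))) *
        ENNReal.ofReal (shellDeviation X μ s m l ω))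
      ≤ ∑' l : ℕ, ENNReal.ofReal (3 * 2 ^ d * a) *
          ENNReal.ofReal (2 ^ (-(p * l)) * min (2 ^ ((d / 2 : ℝ) * l)) (1 + a)) := by
        refine ENNReal.tsum_le_tsum fun l => ?_
        rw [l2norm_const_mul (measurable_shellDeviation hX s m l).ennreal_ofReal]
        refine (mul_le_mul_right (l2norm_shellDeviation_le hX hind hlaw ha.le hm) _).trans
          (le_of_eq ?_)
        rw [← ENNReal.ofReal_mul (by positivity), ← ENNReal.ofReal_mul (by positivity)]
        congr 1
        ring
    _ ≤ ENNReal.ofReal (3 * 2 ^ d * a) * ENNReal.ofReal (C * (1 + a) ^ θ) := by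
        rw [ENNReal.tsum_mul_left]
        gcongr
        exact hlevel _ (by linarith)
    _ ≤ ENNReal.ofReal (6 * 2 ^ d * C * (a + a ^ (1 + θ))) := by
        rw [← ENNReal.ofReal_mul (by positivity)]
        refine ENNReal.ofReal_le_ofReal ?_
        have := mul_one_add_rpow_le ha hθ
        calc 3 * 2 ^ d * a * (C * (1 + a) ^ θ) = 3 * 2 ^ d * C * (a * (1 + a) ^ θ) := by ring
          _ ≤ 3 * 2 ^ d * C * (2 * (a + a ^ (1 + θ))) := by gcongr
          _ = _ := by ring

end Shells

/-! ### Inner and outer shells -/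

section Core

variable {d n : ℕ} {Ω : Type*} [MeasurableSpace Ω] {P : Measure Ω} [IsProbabilityMeasure P]
  {μ : Measure (EuclideanSpace ℝ (Fin d))} [IsProbabilityMeasure μ]
  {X : Fin n → Ω → EuclideanSpace ℝ (Fin d)}

/-- The contribution of the shells `0, …, M` to the multiscale sum. -/
noncomputable def innerSum (X : Fin n → Ω → EuclideanSpace ℝ (Fin d))
    (μ : Measure (EuclideanSpace ℝ (Fin d))) (p s : ℝ) (M : ℕ) (ω : Ω) : ℝ≥0∞ :=
  ∑ m ∈ Finset.range (M + 1), ENNReal.ofReal ((s * 2 ^ m) ^ p) *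
    ∑' l : ℕ, ENNReal.ofReal (2 ^ (-(p * l))) * ENNReal.ofReal (shellDeviation X μ s m l ω)

/-- The contribution of the shells beyond `M` to the multiscale sum. -/
noncomputable def outerSum (X : Fin n → Ω → EuclideanSpace ℝ (Fin d))
    (μ : Measure (EuclideanSpace ℝ (Fin d))) (p s : ℝ) (M : ℕ) (ω : Ω) : ℝ≥0∞ :=
  ∑' m : ℕ, ENNReal.ofReal ((s * 2 ^ (m + (M + 1))) ^ p) *
    ∑' l : ℕ, ENNReal.ofReal (2 ^ (-(p * l))) *
      ENNReal.ofReal (shellDeviation X μ s (m + (M + 1)) l ω)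

lemma multiscaleSum_eq_inner_add_outer {p s : ℝ} (hs : 0 < s) (M : ℕ) (ω : Ω) :
    (multiscaleSum p s fun A => ENNReal.ofReal (maxDeviation X μ A ω))
      = innerSum X μ p s M ω + outerSum X μ p s M ω := by
  rw [multiscaleSum_maxDeviation hs, innerSum, outerSum]
  exact (Summable.sum_add_tsum_nat_add' (k := M + 1) (f := fun m : ℕ =>
    ENNReal.ofReal ((s * 2 ^ m) ^ p) * ∑' l : ℕ, ENNReal.ofReal (2 ^ (-(p * l))) *
      ENNReal.ofReal (shellDeviation X μ s m l ω)) ENNReal.summable).symm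

lemma measurable_innerSum (hX : ∀ i, Measurable (X i)) (p s : ℝ) (M : ℕ) :
    Measurable (innerSum X μ p s M) :=
  Finset.measurable_fun_sum _ fun m _ => (measurable_levelSum hX p s m).const_mul _

/-- No sample point lies in the outer shells, so each deviation there is at most n times the mass of
the shell, and q > p makes the sum over shells converge. -/
lemma outerSum_le {p q s : ℝ} (hs : 0 < s) (hp : 0 < p) (hpq : p < q) {M : ℕ} {ω : Ω}
    (htail : ∀ t : ℝ, 0 < t →
      μ.real {y : EuclideanSpace ℝ (Fin d) | t < ‖y.ofLp‖} ≤ (s / t) ^ q)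
    (hω : ∀ i, ‖(X i ω).ofLp‖ ≤ s * 2 ^ M) :
    outerSum X μ p s M ω ≤ ENNReal.ofReal
      (s ^ p * n * 2 ^ q * geomConst p * geomConst (q - p) * 2 ^ (-((q - p) * (M + 1)))) := by
  have hg := geomConst_pos hp
  have hdev : ∀ m l, shellDeviation X μ s (m + (M + 1)) l ω
      ≤ n * (2 ^ q * 2 ^ (-(q * (m + (M + 1) : ℕ)))) := by
    intro m l
    refine (shellDeviation_le s _ l ω).trans ?_
    have h0 : sampleCount X (shell s ⁻¹' {m + (M + 1)}) ω = 0 := by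
      refine Finset.sum_eq_zero fun i _ => Set.indicator_of_notMem (fun hi => ?_) _
      have hi' : shell s (X i ω) = m + (M + 1) := hi
      exact absurd (hω i) (not_le.2 (lt_norm_of_lt_shell hs (by omega)))
    rw [h0, zero_add]
    gcongr
    exact measureReal_shell_le hs (hp.trans hpq).le htail _
  have hK : (0 : ℝ) ≤ s ^ p * n * 2 ^ q * geomConst p * 2 ^ (-((q - p) * (M + 1))) := by
    positivity
  rw [show s ^ p * n * 2 ^ q * geomConst p * geomConst (q - p) * (2 : ℝ) ^ (-((q - p) * (M + 1)))
    = (s ^ p * n * 2 ^ q * geomConst p * 2 ^ (-((q - p) * (M + 1)))) * geomConst (q - p) by ring,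
    ← tsum_ofReal_geom (by linarith) hK]
  refine ENNReal.tsum_le_tsum fun m => ?_
  calc ENNReal.ofReal ((s * 2 ^ (m + (M + 1))) ^ p) *
        ∑' l : ℕ, ENNReal.ofReal (2 ^ (-(p * l))) *
          ENNReal.ofReal (shellDeviation X μ s (m + (M + 1)) l ω)
      ≤ ENNReal.ofReal ((s * 2 ^ (m + (M + 1))) ^ p) *
        ∑' l : ℕ, ENNReal.ofReal (n * (2 ^ q * 2 ^ (-(q * (m + (M + 1) : ℕ)))) *
          2 ^ (-(p * l))) := by
        gcongr with l
        rw [← ENNReal.ofReal_mul (by positivity), mul_comm]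
        refine ENNReal.ofReal_le_ofReal ?_
        gcongr
        exact hdev m l
    _ = ENNReal.ofReal (s ^ p * n * 2 ^ q * geomConst p * 2 ^ (-((q - p) * (M + 1)))
          * 2 ^ (-((q - p) * m))) := by
        rw [tsum_ofReal_geom hp (by positivity), ← ENNReal.ofReal_mul (by positivity)]
        congr 1
        rw [scale_rpow hs]
        have : (2 : ℝ) ^ (p * (m + (M + 1) : ℕ)) * 2 ^ (-(q * (m + (M + 1) : ℕ)))
            = 2 ^ (-((q - p) * (M + 1))) * 2 ^ (-((q - p) * m)) := by
          rw [← Real.rpow_add (by norm_num), ← Real.rpow_add (by norm_num)]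
          congr 1
          push_cast
          ring
        linear_combination (s ^ p * n * 2 ^ q * geomConst p) * this

lemma measure_exists_norm_gt_le (hX : ∀ i, Measurable (X i)) (hlaw : ∀ i, P.map (X i) = μ)
    {s q : ℝ} (hs : 0 < s)
    (htail : ∀ t : ℝ, 0 < t →
      μ.real {y : EuclideanSpace ℝ (Fin d) | t < ‖y.ofLp‖} ≤ (s / t) ^ q) (M : ℕ) :
    P {ω | ∃ i, s * 2 ^ M < ‖(X i ω).ofLp‖} ≤ ENNReal.ofReal (n * 2 ^ (-(q * M))) := by
  have hm : MeasurableSet {y : EuclideanSpace ℝ (Fin d) | s * 2 ^ M < ‖y.ofLp‖} :=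
    measurableSet_lt measurable_const
      (by fun_prop : Continuous fun y : EuclideanSpace ℝ (Fin d) => ‖y.ofLp‖).measurable
  rw [show {ω | ∃ i, s * 2 ^ M < ‖(X i ω).ofLp‖} = ⋃ i, {ω | s * 2 ^ M < ‖(X i ω).ofLp‖} by
    ext ω; simp]
  refine (measure_iUnion_fintype_le P _).trans ?_
  have h1 : ∀ i, P {ω | s * 2 ^ M < ‖(X i ω).ofLp‖} ≤ ENNReal.ofReal (2 ^ (-(q * M))) := by
    intro i
    have : P {ω | s * 2 ^ M < ‖(X i ω).ofLp‖}
        = μ {y : EuclideanSpace ℝ (Fin d) | s * 2 ^ M < ‖y.ofLp‖} := by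
      rw [← hlaw i, Measure.map_apply (hX i) hm]
      rfl
    rw [this, ← ofReal_measureReal]
    refine ENNReal.ofReal_le_ofReal ((htail _ (by positivity)).trans (le_of_eq ?_))
    rw [div_mul_cancel_left₀ hs.ne', ← Real.rpow_natCast, ← Real.rpow_neg (by norm_num),
      ← Real.rpow_mul (by norm_num)]
    congr 1
    ring
  refine (Finset.sum_le_sum fun i _ => h1 i).trans (le_of_eq ?_)
  rw [Finset.sum_const, Finset.card_univ, Fintype.card_fin, nsmul_eq_mul,
    ENNReal.ofReal_mul (Nat.cast_nonneg n), ENNReal.ofReal_natCast]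

lemma l2norm_innerSum_le (hX : ∀ i, Measurable (X i))
    (hind : iIndepFun X P) (hlaw : ∀ i, P.map (X i) = μ) (hn : 1 ≤ n) {p q s θ C : ℝ}
    (hs : 0 < s) (hq : 0 ≤ q) (hC : 0 < C) (hθ : θ ∈ Set.Icc (0 : ℝ) 1)
    (htail : ∀ t : ℝ, 0 < t →
      μ.real {y : EuclideanSpace ℝ (Fin d) | t < ‖y.ofLp‖} ≤ (s / t) ^ q)
    (hlevel : ∀ b : ℝ, 1 ≤ b →
      ∑' l : ℕ, ENNReal.ofReal (2 ^ (-(p * l)) * min (2 ^ ((d / 2 : ℝ) * l)) b)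
        ≤ ENNReal.ofReal (C * b ^ θ)) (M : ℕ) :
    l2norm P (innerSum X μ p s M) ≤ ENNReal.ofReal (6 * 2 ^ d * C * 2 ^ q * s ^ p *
      ((n : ℝ) ^ (1 / 2 : ℝ) * geomSum (p - q / 2) M
        + (n : ℝ) ^ ((1 + θ) / 2) * geomSum (p - q * ((1 + θ) / 2)) M)) := by
  have hn0 : (0 : ℝ) < n := by exact_mod_cast hn
  refine (l2norm_sum_le _ fun m => (measurable_levelSum hX p s m).const_mul _).trans ?_
  have hterm : ∀ m : ℕ, l2norm P (fun ω => ENNReal.ofReal ((s * 2 ^ m) ^ p) *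
      ∑' l : ℕ, ENNReal.ofReal (2 ^ (-(p * l))) * ENNReal.ofReal (shellDeviation X μ s m l ω))
      ≤ ENNReal.ofReal (6 * 2 ^ d * C * 2 ^ q * s ^ p *
        ((n : ℝ) ^ (1 / 2 : ℝ) * 2 ^ ((p - q / 2) * m)
          + (n : ℝ) ^ ((1 + θ) / 2) * 2 ^ ((p - q * ((1 + θ) / 2)) * m))) := by
    intro m
    rw [l2norm_const_mul (measurable_levelSum hX p s m)]
    -- The square root of the bound n 2^q 2^(-qm) on the expected number of points in shell m.
    set a : ℝ := 2 ^ (q / 2) * (n : ℝ) ^ (1 / 2 : ℝ) * 2 ^ (-(q / 2 * m)) with ha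
    have ha0 : 0 < a := by positivity
    have hapow : ∀ η : ℝ, a ^ η = 2 ^ (q / 2 * η) * (n : ℝ) ^ (1 / 2 * η) *
        2 ^ (-(q / 2 * m) * η) := by
      intro η
      rw [ha, Real.mul_rpow (by positivity) (by positivity),
        Real.mul_rpow (by positivity) (by positivity), ← Real.rpow_mul (by norm_num),
        ← Real.rpow_mul hn0.le, ← Real.rpow_mul (by norm_num)]
    have hm : n * μ.real (shell s ⁻¹' {m}) ≤ a ^ 2 := by
      have h2 := hapow 2
      rw [Real.rpow_two] at h2
      rw [h2, show q / 2 * 2 = q by ring, show (1 / 2 * 2 : ℝ) = 1 by norm_num, Real.rpow_one,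
        show -(q / 2 * (m : ℝ)) * 2 = -(q * m) by ring]
      have := measureReal_shell_le hs hq htail m
      calc (n : ℝ) * μ.real (shell s ⁻¹' {m}) ≤ n * (2 ^ q * 2 ^ (-(q * m))) := by gcongr
        _ = _ := by ring
    refine (mul_le_mul_right (l2norm_levelSum_le hX hind hlaw hC hθ hlevel ha0 hm) _).trans ?_
    rw [← ENNReal.ofReal_mul (by positivity)]
    refine ENNReal.ofReal_le_ofReal ?_
    have h1 : a ≤ 2 ^ q * ((n : ℝ) ^ (1 / 2 : ℝ) * 2 ^ (-(q / 2 * m))) := by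
      rw [ha, mul_assoc]
      gcongr
      · norm_num
      · linarith
    have h2 : a ^ (1 + θ) ≤ 2 ^ q * ((n : ℝ) ^ ((1 + θ) / 2) * 2 ^ (-(q * ((1 + θ) / 2) * m))) := by
      rw [hapow, mul_assoc]
      gcongr ?_ * (?_ * ?_)
      · refine Real.rpow_le_rpow_of_exponent_le (by norm_num) ?_
        nlinarith [hθ.2]
      · apply le_of_eq; congr 1; ring
      · apply le_of_eq; congr 1; ring
    have h3 : (2 : ℝ) ^ (p * m) * 2 ^ (-(q / 2 * m)) = 2 ^ ((p - q / 2) * m) := by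
      rw [← Real.rpow_add (by norm_num)]; congr 1; ring
    have h4 : (2 : ℝ) ^ (p * m) * 2 ^ (-(q * ((1 + θ) / 2) * m))
        = 2 ^ ((p - q * ((1 + θ) / 2)) * m) := by
      rw [← Real.rpow_add (by norm_num)]; congr 1; ring
    rw [scale_rpow hs, ← h3, ← h4]
    calc s ^ p * 2 ^ (p * m) * (6 * 2 ^ d * C * (a + a ^ (1 + θ)))
        ≤ s ^ p * 2 ^ (p * m) * (6 * 2 ^ d * C *
          (2 ^ q * ((n : ℝ) ^ (1 / 2 : ℝ) * 2 ^ (-(q / 2 * m)))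
            + 2 ^ q * ((n : ℝ) ^ ((1 + θ) / 2) * 2 ^ (-(q * ((1 + θ) / 2) * m))))) := by
          gcongr
      _ = _ := by ring
  refine (Finset.sum_le_sum fun m _ => hterm m).trans ?_
  rw [← ENNReal.ofReal_sum_of_nonneg fun _ _ => by positivity]
  refine ENNReal.ofReal_le_ofReal (le_of_eq ?_)
  rw [← Finset.mul_sum, Finset.sum_add_distrib, ← Finset.mul_sum, ← Finset.mul_sum]
  rfl

end Core

/-! ### Truncation and Chebyshev -/

section Bound

/-- `f n v` bounds the probability that `max_k k W_p^p(μ_k, μ)` exceeds `u = v s^p` for samples of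
size `n` from laws with weak moment of order `r p` at most `s`. -/
def IsDeviationBound (d : ℕ) (p r : ℝ) (f : ℕ → ℝ → ℝ) : Prop :=
  ∀ (Ω : Type) [MeasurableSpace Ω] (P : Measure Ω) [IsProbabilityMeasure P]
    (μ : Measure (EuclideanSpace ℝ (Fin d))) [IsProbabilityMeasure μ]
    (n : ℕ) (X : Fin n → Ω → EuclideanSpace ℝ (Fin d)) (s u : ℝ),
    1 ≤ n → 0 < s → 0 < u → (∀ i, Measurable (X i)) → iIndepFun X P → (∀ i, P.map (X i) = μ) →
    (∀ t : ℝ, 0 < t →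
      μ.real {y : EuclideanSpace ℝ (Fin d) | t < ‖y.ofLp‖} ≤ (s / t) ^ (r * p)) →
    P {ω | ENNReal.ofReal u < ⨆ (k : ℕ) (hk : k ∈ Set.Icc 1 n),
      (k : ℝ≥0∞) * wassersteinPow p (empirical fun i : Fin k => X (i.castLE hk.2) ω) μ}
      ≤ ENNReal.ofReal (f n (u / s ^ p))

/-- Unless a point lies beyond the cut, the outer shells use at most u/2, so the inner ones must
exceed the other half, divided by the transport constant (4d)^p. -/
lemma measure_maxCost_gt_le {d n : ℕ} {Ω : Type*} [MeasurableSpace Ω] {P : Measure Ω}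
    [IsProbabilityMeasure P] {μ : Measure (EuclideanSpace ℝ (Fin d))} [IsProbabilityMeasure μ]
    {X : Fin n → Ω → EuclideanSpace ℝ (Fin d)} (hX : ∀ i, Measurable (X i)) {p s u a b c : ℝ}
    {M : ℕ} (hd : 1 ≤ d) (hp : 1 ≤ p) (hs : 0 < s) (hu : 0 < u) (hc : 0 ≤ c)
    (hμ : ∫⁻ y, ENNReal.ofReal ((s * 2 ^ shell s y) ^ p) ∂μ ≠ ∞)
    (hbad : P {ω | ∃ i, s * 2 ^ M < ‖(X i ω).ofLp‖} ≤ ENNReal.ofReal a)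
    (houter : ∀ ω, (∀ i, ‖(X i ω).ofLp‖ ≤ s * 2 ^ M) →
      outerSum X μ p s M ω ≤ ENNReal.ofReal b)
    (hb : (4 * d) ^ p * b ≤ u / 2)
    (hinner : l2norm P (innerSum X μ p s M) ≤ ENNReal.ofReal c) :
    P {ω | ENNReal.ofReal u < ⨆ (k : ℕ) (hk : k ∈ Set.Icc 1 n),
      (k : ℝ≥0∞) * wassersteinPow p (empirical fun i : Fin k => X (i.castLE hk.2) ω) μ}
      ≤ ENNReal.ofReal a + ENNReal.ofReal ((c / (u / (2 * (4 * d) ^ p))) ^ 2) := by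
  have hd0 : (0 : ℝ) < d := by exact_mod_cast hd
  have hK : (0 : ℝ) < (4 * d) ^ p := by positivity
  refine (measure_mono (t := {ω | ∃ i, s * 2 ^ M < ‖(X i ω).ofLp‖} ∪
    {ω | ENNReal.ofReal (u / (2 * (4 * d) ^ p)) < innerSum X μ p s M ω}) ?_).trans
    ((measure_union_le _ _).trans (add_le_add hbad
      (measure_lt_le_l2norm (measurable_innerSum hX p s M) (by positivity) hc hinner)))
  intro ω (hω : ENNReal.ofReal u < _)
  by_contra hcon
  simp only [Set.mem_union, Set.mem_ofPred_eq, not_or, not_exists, not_lt] at hcon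
  refine absurd hω (not_lt.2 ((mul_wassersteinPow_le hp hs hμ ω).trans ?_))
  rw [multiscaleSum_eq_inner_add_outer hs M]
  calc ENNReal.ofReal ((4 * d) ^ p) * (innerSum X μ p s M ω + outerSum X μ p s M ω)
      ≤ ENNReal.ofReal ((4 * d) ^ p) *
        (ENNReal.ofReal (u / (2 * (4 * d) ^ p)) + ENNReal.ofReal b) := by
        gcongr
        · exact hcon.2
        · exact houter ω hcon.1
    _ ≤ ENNReal.ofReal u := by
        rw [mul_add, ← ENNReal.ofReal_mul hK.le, ← ENNReal.ofReal_mul hK.le,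
          show (4 * d : ℝ) ^ p * (u / (2 * (4 * d) ^ p)) = u / 2 by field_simp]
        refine (add_le_add le_rfl (ENNReal.ofReal_le_ofReal hb)).trans (le_of_eq ?_)
        rw [← ENNReal.ofReal_add (by positivity) (by positivity), add_halves]

/-- The index of the shell at which the sample is truncated. -/
noncomputable def cutShell (p v : ℝ) : ℕ := ⌊Real.logb 2 v / p⌋₊

lemma two_rpow_cutShell_le {p v : ℝ} (hp : 0 < p) (hv : 1 ≤ v) :
    (2 : ℝ) ^ (p * cutShell p v) ≤ v := by
  have h1 : (cutShell p v : ℝ) ≤ Real.logb 2 v / p :=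
    Nat.floor_le (div_nonneg (Real.logb_nonneg (by norm_num) hv) hp.le)
  rw [le_div_iff₀ hp, Real.le_logb_iff_rpow_le (by norm_num) (by linarith)] at h1
  rwa [mul_comm]

lemma lt_two_rpow_cutShell {p v : ℝ} (hp : 0 < p) (hv : 1 ≤ v) :
    v < (2 : ℝ) ^ (p * (cutShell p v + 1)) := by
  have h1 : Real.logb 2 v / p < cutShell p v + 1 := Nat.lt_floor_add_one _
  rw [div_lt_iff₀ hp, Real.logb_lt_iff_lt_rpow (by norm_num) (by linarith)] at h1
  rwa [mul_comm]

/-- The choice 2^(pM) ≤ v < 2^(p(M+1)) balances the pieces: the union bound, the outer shells and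
the first inner sum all become multiples of n v^(-r), and only the inner sum of exponent (1 + θ)/2
is left to evaluate. -/
lemma exists_isDeviationBound {d : ℕ} (hd : 1 ≤ d) {p r θ C₀ : ℝ} (hp : 1 ≤ p)
    (hr : r ∈ Set.Ioo (1 : ℝ) 2) (hθ : θ ∈ Set.Icc (0 : ℝ) 1) (hC₀ : 0 < C₀)
    (hlevel : ∀ b : ℝ, 1 ≤ b →
      ∑' l : ℕ, ENNReal.ofReal (2 ^ (-(p * l)) * min (2 ^ ((d / 2 : ℝ) * l)) b)
        ≤ ENNReal.ofReal (C₀ * b ^ θ)) :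
    ∃ C : ℝ, 0 < C ∧ IsDeviationBound d p r fun n v =>
      if v < 1 then 1 else min 1 (C * (n * v ^ (-r) + ((n : ℝ) ^ ((1 + θ) / 2) *
        geomSum (p - r * p * ((1 + θ) / 2)) (cutShell p v) / v) ^ 2)) := by
  obtain ⟨hr1, hr2⟩ := hr
  have hp0 : 0 < p := by linarith
  have hd0 : (0 : ℝ) < d := by exact_mod_cast hd
  set q := r * p with hq
  have hpq : p < q := by rw [hq]; nlinarith
  have hq0 : 0 < q := hp0.trans hpq
  have he : 0 < p - q / 2 := by rw [hq]; nlinarith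
  set K : ℝ := (4 * d) ^ p with hK
  have hK0 : 0 < K := by positivity
  set g := geomConst (p - q / 2) with hg
  have hg0 : 0 < g := geomConst_pos he
  set C₁ : ℝ := 6 * 2 ^ d * C₀ * 2 ^ q with hC₁
  have hC₁0 : 0 < C₁ := by positivity
  have hgp := geomConst_pos hp0
  have hgq := geomConst_pos (sub_pos.2 hpq)
  set C₂ : ℝ := K * (2 ^ q * geomConst p * geomConst (q - p)) with hC₂
  have hC₂0 : 0 < C₂ := by positivity
  -- The summands serve, in order, the trivial case `hbig`, the union bound and Chebyshev's
  -- inequality.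
  refine ⟨2 * C₂ + 2 ^ q + 8 * K ^ 2 * C₁ ^ 2 * (g ^ 2 + 1), by positivity, ?_⟩
  intro Ω _ P _ μ _ n X s u hn hs hu hX hind hlaw htail
  have hn0 : (0 : ℝ) < n := by exact_mod_cast hn
  set v := u / s ^ p with hv
  have hsp : 0 < s ^ p := by positivity
  have hv0 : 0 < v := by positivity
  have huv : u = s ^ p * v := by rw [hv]; field_simp
  have htriv : ∀ A : Set Ω, P A ≤ ENNReal.ofReal 1 := fun A => by
    rw [ENNReal.ofReal_one]; exact prob_le_one
  dsimp only
  split_ifs with hv1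
  · exact htriv _
  rw [not_lt] at hv1
  set M := cutShell p v with hM
  have hM1 : (2 : ℝ) ^ (p * M) ≤ v := two_rpow_cutShell_le hp0 hv1
  have hM2 : v < (2 : ℝ) ^ (p * (M + 1)) := lt_two_rpow_cutShell hp0 hv1
  set Y : ℝ := (n : ℝ) ^ ((1 + θ) / 2) * geomSum (p - q * ((1 + θ) / 2)) M / v with hY
  set ρ : ℝ := n * v ^ (-r) with hρ
  have hρ0 : 0 < ρ := by positivity
  rw [ENNReal.ofReal_min]
  refine le_min (htriv _) ?_
  -- The outer shells cost at most u C₂ ρ. Either this is below u/2, or the claimed bound exceeds 1.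
  by_cases hbig : 1 / 2 ≤ C₂ * ρ
  · refine (htriv _).trans (ENNReal.ofReal_le_ofReal ?_)
    have h1 : 2 * C₂ ≤ 2 * C₂ + 2 ^ q + 8 * K ^ 2 * C₁ ^ 2 * (g ^ 2 + 1) := by
      have : 0 ≤ 2 ^ q + 8 * K ^ 2 * C₁ ^ 2 * (g ^ 2 + 1) := by positivity
      linarith
    calc (1 : ℝ) ≤ 2 * C₂ * ρ := by linarith
      _ ≤ _ := mul_le_mul h1 (le_add_of_nonneg_right (sq_nonneg _)) hρ0.le (by positivity)
  rw [not_le] at hbig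
  have hpow : ∀ e : ℝ, 0 ≤ e → (2 : ℝ) ^ (-(e * p * (M + 1))) ≤ v ^ (-e) := by
    intro e he
    rw [show -(e * p * ((M : ℝ) + 1)) = p * (M + 1) * (-e) by ring, Real.rpow_mul (by norm_num)]
    exact Real.rpow_le_rpow_of_nonpos hv0 hM2.le (by linarith)
  have hbadle : (n : ℝ) * 2 ^ (-(q * M)) ≤ 2 ^ q * ρ := by
    have h1 := hpow r (by linarith)
    have h2 : (2 : ℝ) ^ (-(q * M)) = 2 ^ q * 2 ^ (-(r * p * (M + 1))) := by
      rw [← Real.rpow_add (by norm_num), hq]; congr 1; ring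
    rw [h2, hρ]
    calc (n : ℝ) * (2 ^ q * 2 ^ (-(r * p * (M + 1)))) ≤ n * (2 ^ q * v ^ (-r)) := by gcongr
      _ = _ := by ring
  have houter := fun ω hω => outerSum_le (X := X) (M := M) (ω := ω) hs hp0 hpq htail hω
  have hb : K * (s ^ p * n * 2 ^ q * geomConst p * geomConst (q - p) *
      2 ^ (-((q - p) * (M + 1)))) ≤ u / 2 := by
    have h1 := hpow (r - 1) (by linarith)
    rw [show (r - 1) * p = q - p by rw [hq]; ring] at h1
    calc K * (s ^ p * n * 2 ^ q * geomConst p * geomConst (q - p) * 2 ^ (-((q - p) * (M + 1))))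
        ≤ K * (s ^ p * n * 2 ^ q * geomConst p * geomConst (q - p) * v ^ (-(r - 1))) := by
          gcongr
      _ = s ^ p * v * (C₂ * ρ) := by
          rw [hC₂, hρ, show -(r - 1) = 1 + -r by ring, Real.rpow_add hv0, Real.rpow_one]
          ring
      _ ≤ s ^ p * v * (1 / 2) := by gcongr
      _ = u / 2 := by rw [huv]; ring
  have hmain := measure_maxCost_gt_le hX hd hp hs hu
    (mul_nonneg (by positivity) (add_nonneg (mul_nonneg (by positivity) (geomSum_nonneg _ _))
      (mul_nonneg (by positivity) (geomSum_nonneg _ _))))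
    (lintegral_shell_ne_top hs hq0.le hpq htail)
    (measure_exists_norm_gt_le hX hlaw hs htail M) houter hb
    (l2norm_innerSum_le hX hind hlaw hn hs hq0.le hC₀ hθ htail hlevel M)
  refine hmain.trans ?_
  rw [← ENNReal.ofReal_add (by positivity) (by positivity)]
  refine ENNReal.ofReal_le_ofReal ?_
  set Y₁ : ℝ := (n : ℝ) ^ (1 / 2 : ℝ) * geomSum (p - q / 2) M / v with hY₁
  -- As r < 2, the exponent p - q/2 is positive and the last shell governs the sum, which is of
  -- order v^(1 - r/2).
  have hY₁le : Y₁ ^ 2 ≤ g ^ 2 * ρ := by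
    have h1 : geomSum (p - q / 2) M ≤ v ^ (1 - r / 2) * g := by
      refine (geomSum_le_of_pos he M).trans ?_
      gcongr
      rw [show (p - q / 2) * (M : ℝ) = p * M * (1 - r / 2) by rw [hq]; ring,
        Real.rpow_mul (by norm_num)]
      exact Real.rpow_le_rpow (by positivity) hM1 (by linarith)
    have h2 : Y₁ ≤ (n : ℝ) ^ (1 / 2 : ℝ) * (v ^ (1 - r / 2) * g) / v := by
      rw [hY₁]; gcongr
    have h3 : 0 ≤ Y₁ := div_nonneg (mul_nonneg (by positivity) (geomSum_nonneg _ _)) hv0.le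
    refine (pow_le_pow_left₀ h3 h2 2).trans (le_of_eq ?_)
    have h4 : ((n : ℝ) ^ (1 / 2 : ℝ)) ^ 2 = n := by
      rw [← Real.rpow_natCast, ← Real.rpow_mul hn0.le]; norm_num
    have h5 : (v ^ (1 - r / 2)) ^ 2 = v ^ 2 * v ^ (-r) := by
      rw [← Real.rpow_natCast, ← Real.rpow_natCast, ← Real.rpow_mul hv0.le, ← Real.rpow_add hv0]
      congr 1
      push_cast
      ring
    rw [div_pow, mul_pow, mul_pow, h4, h5, hρ]
    field_simp
  have hform : C₁ * s ^ p * ((n : ℝ) ^ (1 / 2 : ℝ) * geomSum (p - q / 2) M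
      + (n : ℝ) ^ ((1 + θ) / 2) * geomSum (p - q * ((1 + θ) / 2)) M) / (u / (2 * K))
      = 2 * K * C₁ * (Y₁ + Y) := by
    rw [hY₁, hY, huv]
    field_simp
  rw [hform]
  have h6 : (Y₁ + Y) ^ 2 ≤ 2 * (g ^ 2 * ρ) + 2 * Y ^ 2 := by
    nlinarith [sq_nonneg (Y₁ - Y)]
  calc (n : ℝ) * 2 ^ (-(q * M)) + (2 * K * C₁ * (Y₁ + Y)) ^ 2
      = n * 2 ^ (-(q * M)) + 4 * K ^ 2 * C₁ ^ 2 * (Y₁ + Y) ^ 2 := by ring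
    _ ≤ 2 ^ q * ρ + 4 * K ^ 2 * C₁ ^ 2 * (2 * (g ^ 2 * ρ) + 2 * Y ^ 2) := by gcongr
    _ ≤ _ := by
        have h7 : 0 ≤ 2 * C₂ * (ρ + Y ^ 2) := by positivity
        have h8 : 0 ≤ 2 ^ q * Y ^ 2 := by positivity
        have h9 : 0 ≤ 8 * K ^ 2 * C₁ ^ 2 * (g ^ 2 * Y ^ 2 + ρ) := by positivity
        linarith

end Bound

/-! ### The three regimes -/

section Rates

/-- The deviation rate in terms of the normalized level `v = n x / N^p`. -/
noncomputable def scaledRate (d : ℕ) (p r : ℝ) (n : ℕ) (v : ℝ) : ℝ :=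
  if p > d * (r - 1) / r then n * v ^ (-r)
  else if p = d * (r - 1) / r then
    n * v ^ (-r) * (Real.log n) ^ r * (1 + Real.posLog (v ^ (1 / p))) ^ r
  else (n : ℝ) ^ (r - r * p / d) * v ^ (-r)

lemma deviationRate_eq_scaledRate {d : ℕ} (hd : 1 ≤ d) {p r N x : ℝ} {n : ℕ} (hp : 1 ≤ p)
    (hr : 1 < r) (hN : 0 < N) (hn : 1 ≤ n) (hx : 0 < x) :
    deviationRate d p r N n x = scaledRate d p r n (n * x / N ^ p) := by
  have hn0 : (0 : ℝ) < n := by exact_mod_cast hn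
  have hd0 : (0 : ℝ) < d := by exact_mod_cast hd
  have hp0 : 0 < p := by linarith
  have hv : (n * x / N ^ p) ^ (-r) = N ^ (r * p) / (x ^ r * (n : ℝ) ^ r) := by
    rw [Real.rpow_neg (by positivity), Real.div_rpow (by positivity) (by positivity),
      Real.mul_rpow hn0.le hx.le, ← Real.rpow_mul hN.le, inv_div, mul_comm p r, mul_comm (x ^ r)]
  have h1 : (n : ℝ) * (n * x / N ^ p) ^ (-r) = N ^ (r * p) / (x ^ r * (n : ℝ) ^ (r - 1)) := by
    rw [hv, Real.rpow_sub hn0, Real.rpow_one]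
    field_simp
  unfold deviationRate scaledRate
  split_ifs with hc1 hc2
  · exact h1.symm
  · rw [h1]
    have h2 : x ^ (1 / p) * (n : ℝ) ^ (r / (d * r - d)) / N = (n * x / N ^ p) ^ (1 / p) := by
      -- At the critical exponent the argument of the logarithm is exactly v^(1/p).
      have h3 : r / (d * r - d) = 1 / p := by
        rw [hc2]
        have : r - 1 ≠ 0 := by linarith
        have : (d : ℝ) * r - d ≠ 0 := by
          rw [← mul_sub_one]; positivity
        field_simp
      rw [h3, Real.div_rpow (by positivity) (by positivity), Real.mul_rpow hn0.le hx.le,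
        ← Real.rpow_mul hN.le, mul_one_div_cancel hp0.ne', Real.rpow_one, mul_comm (x ^ (1 / p))]
    rw [h2]
    ring
  · rw [hv, Real.rpow_sub hn0]
    field_simp

/-- Use 1 if y ≥ 1, and y² ≤ y^r if y ≤ 1, as r < 2. A Chebyshev bound thus gains the decay of order
r. -/
lemma min_one_le_rpow {y c r : ℝ} (hy : 0 ≤ y) (hc : 1 ≤ c) (hr : r ∈ Set.Ioo (1 : ℝ) 2)
    {ρ : ℝ} (hρ : ρ ≤ y ^ r) : min 1 (c * (ρ + y ^ 2)) ≤ 2 * c * y ^ r := by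
  obtain ⟨hr1, hr2⟩ := hr
  rcases le_total 1 y with h | h
  · have : 1 ≤ y ^ r := Real.one_le_rpow h (by linarith)
    refine (min_le_left _ _).trans ?_
    nlinarith
  · refine (min_le_right _ _).trans ?_
    have h2 : y ^ 2 ≤ y ^ r := by
      rcases hy.eq_or_lt with h0 | h0
      · rw [← h0, Real.zero_rpow (by linarith)]; simp
      · rw [← Real.rpow_two]
        exact Real.rpow_le_rpow_of_exponent_ge h0 h hr2.le
    nlinarith

lemma div_rpow_eq {a v r : ℝ} (ha : 0 ≤ a) (hv : 0 < v) : (a / v) ^ r = a ^ r * v ^ (-r) := by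
  rw [Real.div_rpow ha hv.le, Real.rpow_neg hv.le, div_eq_mul_inv]

/-- The level sum needs θ > 1 - 2p/d, and a positive exponent in the shell sum needs r(1 + θ)/2 < 1,
that is θ < 2/r - 1. The two are compatible exactly when p > d(r-1)/r. -/
lemma exists_deviationBound_of_gt {d : ℕ} (hd : 1 ≤ d) {p r : ℝ} (hp : 1 ≤ p)
    (hr : r ∈ Set.Ioo (1 : ℝ) 2) (h : d * (r - 1) / r < p) :
    ∃ (C : ℝ) (f : ℕ → ℝ → ℝ), 0 < C ∧ IsDeviationBound d p r f ∧
      ∀ n : ℕ, 1 ≤ n → ∀ v : ℝ, 0 < v → f n v ≤ C * (n * v ^ (-r)) := by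
  have hr1 := hr.1
  have hr2 := hr.2
  have hp0 : 0 < p := by linarith
  have hd0 : (0 : ℝ) < d := by exact_mod_cast hd
  have hr0 : 0 < r := by linarith
  have hlt : max 0 (1 - 2 * p / d) < 2 / r - 1 := by
    refine max_lt ?_ ?_
    · rw [sub_pos, lt_div_iff₀ hr0]; linarith
    · rw [div_lt_iff₀ hr0] at h
      have : 1 - 2 * p / d - (2 / r - 1) = 2 * (d * (r - 1) - p * r) / (d * r) := by
        field_simp
        ring
      have h2 : 2 * (d * (r - 1) - p * r) / (d * r) < 0 :=
        div_neg_of_neg_of_pos (by linarith) (by positivity)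
      linarith
  obtain ⟨θ, hθ1, hθ2⟩ := exists_between hlt
  have hθ0 : 0 < θ := (le_max_left _ _).trans_lt hθ1
  have hθd : 1 - 2 * p / d < θ := (le_max_right _ _).trans_lt hθ1
  have hθle : θ ≤ 1 := by
    have : 2 / r < 2 := by rw [div_lt_iff₀ hr0]; linarith
    linarith
  have hlev : (d / 2 : ℝ) * (1 - θ) < p := by
    have : (d / 2 : ℝ) * (1 - θ) < d / 2 * (2 * p / d) := by gcongr; linarith
    refine this.trans_eq ?_
    field_simp
  obtain ⟨C₀, hC₀, hlevel⟩ := exists_levelSum_le_of_lt ⟨hθ0.le, hθle⟩ hlev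
  obtain ⟨C, hC, hbound⟩ := exists_isDeviationBound hd hp hr ⟨hθ0.le, hθle⟩ hC₀ hlevel
  have he : 0 < p - r * p * ((1 + θ) / 2) := by
    have h1 : r * ((1 + θ) / 2) < 1 := by
      have : r * (θ + 1) < r * (2 / r) := by gcongr; linarith
      rw [mul_div_cancel₀ _ hr0.ne'] at this
      linarith
    nlinarith
  set g := geomConst (p - r * p * ((1 + θ) / 2)) with hg
  have hg0 : 0 < g := geomConst_pos he
  refine ⟨1 + C * (1 + g ^ 2), _, by positivity, hbound, fun n hn v hv => ?_⟩
  have hn0 : (0 : ℝ) < n := by exact_mod_cast hn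
  have hn1 : (1 : ℝ) ≤ n := by exact_mod_cast hn
  set ρ : ℝ := n * v ^ (-r) with hρ
  have hρ0 : 0 < ρ := by positivity
  have hone : 1 ≤ ρ → 1 ≤ (1 + C * (1 + g ^ 2)) * ρ := by
    intro h1
    have : 0 ≤ C * (1 + g ^ 2) * ρ := by positivity
    linarith
  split_ifs with hv1
  · refine hone ?_
    have h1 : 1 ≤ v ^ (-r) := Real.one_le_rpow_of_pos_of_le_one_of_nonpos hv hv1.le (by linarith)
    rw [hρ]; nlinarith
  rw [not_lt] at hv1
  rcases le_total 1 ρ with h1 | h1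
  · exact (min_le_left _ _).trans (hone h1)
  refine (min_le_right _ _).trans ?_
  set τ := (1 + θ) / 2 with hτ
  have hG : geomSum (p - r * p * τ) (cutShell p v) ≤ v ^ (1 - r * τ) * g := by
    refine (geomSum_le_of_pos he _).trans ?_
    gcongr
    rw [show (p - r * p * τ) * (cutShell p v : ℝ) = p * cutShell p v * (1 - r * τ) by ring,
      Real.rpow_mul (by norm_num)]
    exact Real.rpow_le_rpow (by positivity) (two_rpow_cutShell_le hp0 hv1) (by nlinarith)
  have hY : (n : ℝ) ^ τ * geomSum (p - r * p * τ) (cutShell p v) / v ≤ g * ρ ^ τ := by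
    calc (n : ℝ) ^ τ * geomSum (p - r * p * τ) (cutShell p v) / v
        ≤ (n : ℝ) ^ τ * (v ^ (1 - r * τ) * g) / v := by gcongr
      _ = g * ρ ^ τ := by
          rw [hρ, Real.mul_rpow hn0.le (by positivity), ← Real.rpow_mul hv.le,
            show 1 - r * τ = 1 + -r * τ by ring, Real.rpow_add hv, Real.rpow_one]
          field_simp
  have hY2 : ((n : ℝ) ^ τ * geomSum (p - r * p * τ) (cutShell p v) / v) ^ 2 ≤ g ^ 2 * ρ := by
    refine (pow_le_pow_left₀ (div_nonneg (mul_nonneg (by positivity) (geomSum_nonneg _ _)) hv.le)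
      hY 2).trans ?_
    rw [mul_pow]
    gcongr
    rw [← Real.rpow_natCast, ← Real.rpow_mul hρ0.le]
    -- Here 2τ = 1 + θ ≥ 1 and ρ ≤ 1.
    calc ρ ^ (τ * (2 : ℕ)) ≤ ρ ^ (1 : ℝ) :=
          Real.rpow_le_rpow_of_exponent_ge hρ0 h1 (by rw [hτ]; push_cast; linarith)
      _ = ρ := Real.rpow_one _
  calc C * (ρ + ((n : ℝ) ^ τ * geomSum (p - r * p * τ) (cutShell p v) / v) ^ 2)
      ≤ C * (ρ + g ^ 2 * ρ) := by gcongr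
    _ ≤ (1 + C * (1 + g ^ 2)) * ρ := by nlinarith

/-- Since r < 2, p < d/2 and the critical level sum applies with θ = 1 - 2p/d, so (1 + θ)/2 = 1 -
p/d. The constant is enlarged to C ≥ 1 for `min_one_le_rpow`. -/
lemma exists_deviationBound_of_le {d : ℕ} (hd : 1 ≤ d) {p r : ℝ} (hp : 1 ≤ p)
    (hr : r ∈ Set.Ioo (1 : ℝ) 2) (h : p ≤ d * (r - 1) / r) :
    ∃ C : ℝ, 1 ≤ C ∧ IsDeviationBound d p r fun n v =>
      if v < 1 then 1 else min 1 (C * (n * v ^ (-r) + ((n : ℝ) ^ (1 - p / d) *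
        geomSum (p - r * p * (1 - p / d)) (cutShell p v) / v) ^ 2)) := by
  have hr1 := hr.1
  have hr2 := hr.2
  have hp0 : 0 < p := by linarith
  have hd0 : (0 : ℝ) < d := by exact_mod_cast hd
  have hr0 : 0 < r := by linarith
  have hpd : p < (d / 2 : ℝ) := by
    refine h.trans_lt ?_
    rw [div_lt_div_iff₀ hr0 (by norm_num)]
    nlinarith
  have hθ : (1 - p / (d / 2 : ℝ)) ∈ Set.Icc (0 : ℝ) 1 := by
    constructor
    · rw [sub_nonneg, div_le_one (by positivity)]; exact hpd.le
    · have : 0 ≤ p / (d / 2 : ℝ) := by positivity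
      linarith
  obtain ⟨C₀, hC₀, hlevel⟩ := exists_levelSum_le_critical hp0 hpd
  obtain ⟨C, hC, hbound⟩ := exists_isDeviationBound hd hp hr hθ hC₀ hlevel
  have hτ : (1 + (1 - p / (d / 2 : ℝ))) / 2 = 1 - p / d := by field_simp; ring
  rw [hτ] at hbound
  refine ⟨C + 1, by linarith, ?_⟩
  intro Ω _ P _ μ _ n X s u hn hs hu hX hind hlaw htail
  refine (hbound Ω P μ n X s u hn hs hu hX hind hlaw htail).trans (ENNReal.ofReal_le_ofReal ?_)
  dsimp only
  split_ifs
  · exact le_rfl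
  · gcongr
    linarith

lemma exists_deviationBound {d : ℕ} (hd : 1 ≤ d) {p r : ℝ} (hp : 1 ≤ p)
    (hr : r ∈ Set.Ioo (1 : ℝ) 2) :
    ∃ (C : ℝ) (f : ℕ → ℝ → ℝ), 0 < C ∧ IsDeviationBound d p r f ∧
      ∀ n : ℕ, 1 ≤ n → (p = d * (r - 1) / r → 2 ≤ n) → ∀ v : ℝ, 0 < v →
        f n v ≤ C * scaledRate d p r n v := by
  have hr1 := hr.1
  have hr2 := hr.2
  have hp0 : 0 < p := by linarith
  have hd0 : (0 : ℝ) < d := by exact_mod_cast hd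
  have hr0 : 0 < r := by linarith
  rcases lt_trichotomy (d * (r - 1) / r) p with h | h | h
  · obtain ⟨C, f, hC, hf, hle⟩ := exists_deviationBound_of_gt hd hp hr h
    refine ⟨C, f, hC, hf, fun n hn _ v hv => ?_⟩
    rw [scaledRate, if_pos h]
    exact hle n hn v hv
  · obtain ⟨C, hC, hf⟩ := exists_deviationBound_of_le hd hp hr h.symm.le
    have hl2 : 0 < Real.log 2 := Real.log_pos (by norm_num)
    have hl21 : Real.log 2 ≤ 1 := by linarith [Real.log_two_lt_d9]
    set κ := (Real.log 2) ^ r with hκ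
    have hκ0 : 0 < κ := by positivity
    have hCpos : 0 < C := by linarith
    -- One κ comes from bounding M + 1 by Λ / log 2, the other from inserting (log n)^r, which
    -- enters only through log n ≥ log 2; hence n ≥ 2.
    refine ⟨2 * C / κ / κ, _, by positivity, hf, fun n hn hn2 v hv => ?_⟩
    have hn2 : (2 : ℝ) ≤ n := by exact_mod_cast hn2 h.symm
    have hn0 : (0 : ℝ) < n := by linarith
    set Λ := 1 + Real.posLog (v ^ (1 / p)) with hΛ
    have hsr : scaledRate d p r n v = n * v ^ (-r) * (Real.log n) ^ r * Λ ^ r := by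
      rw [scaledRate, if_neg (not_lt.2 h.symm.le), if_pos h.symm]
    rw [hsr]
    have hΛ1 : 1 ≤ Λ := by
      have := Real.posLog_nonneg (x := v ^ (1 / p))
      linarith
    have hexp : 1 - p / d = 1 / r := by
      rw [← h]; field_simp; ring
    set y := (n : ℝ) ^ (1 / r) * (Λ / Real.log 2) / v with hy
    have hy0 : 0 < y := by positivity
    have hyr : y ^ r = n * v ^ (-r) * Λ ^ r / κ := by
      rw [hy, div_rpow_eq (by positivity) hv, Real.mul_rpow (by positivity) (by positivity),
        ← Real.rpow_mul hn0.le, one_div_mul_cancel hr0.ne', Real.rpow_one,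
        Real.div_rpow (by positivity) hl2.le]
      ring
    have hlogn : κ ≤ (Real.log n) ^ r := by
      refine Real.rpow_le_rpow hl2.le ?_ hr0.le
      exact Real.log_le_log (by norm_num) hn2
    have hrate : 2 * C * y ^ r
        ≤ 2 * C / κ / κ * (n * v ^ (-r) * (Real.log n) ^ r * Λ ^ r) := by
      rw [hyr]
      calc 2 * C * (n * v ^ (-r) * Λ ^ r / κ)
          = 2 * C / κ / κ * (n * v ^ (-r) * κ * Λ ^ r) := by field_simp
        _ ≤ _ := by gcongr
    refine le_trans ?_ hrate
    have hΛl : 1 ≤ Λ / Real.log 2 := by rw [le_div_iff₀ hl2]; linarith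
    have hn1r : 1 ≤ (n : ℝ) ^ (1 / r) := Real.one_le_rpow (by linarith) (by positivity)
    split_ifs with hv1
    · have h1 : 1 ≤ y := by
        rw [hy, one_le_div hv]
        nlinarith
      have := Real.one_le_rpow h1 hr0.le
      nlinarith
    rw [not_lt] at hv1
    -- The exponent is 0, so the sum counts the M + 1 shells, and M log 2 ≤ log v^(1/p).
    have hgeom : geomSum (p - r * p * (1 - p / d)) (cutShell p v) ≤ Λ / Real.log 2 := by
      rw [hexp, show p - r * p * (1 / r) = 0 by field_simp; ring, geomSum_zero, le_div_iff₀ hl2]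
      have h1 : (cutShell p v : ℝ) ≤ Real.logb 2 v / p :=
        Nat.floor_le (div_nonneg (Real.logb_nonneg (by norm_num) hv1) hp0.le)
      have h2 : Real.logb 2 v / p * Real.log 2 = Real.log (v ^ (1 / p)) := by
        rw [Real.log_rpow hv, Real.logb]
        field_simp
      have h3 : Real.log (v ^ (1 / p)) ≤ Real.posLog (v ^ (1 / p)) := le_max_right _ _
      have h4 := mul_le_mul_of_nonneg_right h1 hl2.le
      rw [hΛ]
      linarith
    refine le_trans ?_ (min_one_le_rpow hy0.le hC hr (ρ := n * v ^ (-r)) ?_)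
    · have hg := geomSum_nonneg (p - r * p * (1 - p / d)) (cutShell p v)
      rw [← hexp] at hy
      rw [hy]
      gcongr
    · rw [hyr, le_div_iff₀ hκ0]
      have h1 : 1 ≤ Λ ^ r := Real.one_le_rpow hΛ1 hr0.le
      have h2 : κ ≤ 1 := Real.rpow_le_one hl2.le hl21 hr0.le
      have h3 : 0 < n * v ^ (-r) := by positivity
      nlinarith
  · obtain ⟨C, hC, hf⟩ := exists_deviationBound_of_le hd hp hr h.le
    have hrp : r * p < d * (r - 1) := by
      rw [lt_div_iff₀ hr0] at h; linarith
    have he : p - r * p * (1 - p / d) < 0 := by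
      have h1 : 1 < r * (1 - p / d) := by
        have : r * (1 - p / d) - 1 = (d * (r - 1) - r * p) / d := by field_simp; ring
        have h2 : 0 < (d * (r - 1) - r * p) / d := div_pos (by linarith) hd0
        linarith
      nlinarith
    -- The shell sum is bounded, its exponent being negative. The added 1 gives g ≥ 1, used to
    -- absorb n v^(-r) into y^r.
    set g := 1 + geomConst (-(p - r * p * (1 - p / d))) with hg
    have hg1 : 1 ≤ g := by
      have := geomConst_pos (neg_pos.2 he)
      linarith
    have hCpos : 0 < C := by linarith
    refine ⟨2 * C * g ^ r, _, by positivity, hf, fun n hn _ v hv => ?_⟩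
    have hn0 : (0 : ℝ) < n := by exact_mod_cast hn
    have hn1 : (1 : ℝ) ≤ n := by exact_mod_cast hn
    have hsr : scaledRate d p r n v = (n : ℝ) ^ (r - r * p / d) * v ^ (-r) := by
      rw [scaledRate, if_neg (not_lt.2 h.le), if_neg h.ne]
    rw [hsr]
    set y := (n : ℝ) ^ (1 - p / d) * g / v with hy
    have hy0 : 0 < y := by positivity
    have hyr : y ^ r = g ^ r * ((n : ℝ) ^ (r - r * p / d) * v ^ (-r)) := by
      rw [hy, div_rpow_eq (by positivity) hv, Real.mul_rpow (by positivity) (by positivity),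
        ← Real.rpow_mul hn0.le, show (1 - p / d) * r = r - r * p / d by ring]
      ring
    rw [mul_assoc (2 * C), ← hyr]
    have hexp : 1 ≤ r - r * p / d := by
      have : r - r * p / d - 1 = (d * (r - 1) - r * p) / d := by field_simp; ring
      have h2 : 0 < (d * (r - 1) - r * p) / d := div_pos (by linarith) hd0
      linarith
    have hρ : n * v ^ (-r) ≤ y ^ r := by
      rw [hyr]
      have h1 : (n : ℝ) ≤ (n : ℝ) ^ (r - r * p / d) := by
        conv_lhs => rw [← Real.rpow_one (n : ℝ)]
        exact Real.rpow_le_rpow_of_exponent_le hn1 hexp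
      have h2 : 1 ≤ g ^ r := Real.one_le_rpow hg1 hr0.le
      calc n * v ^ (-r) ≤ (n : ℝ) ^ (r - r * p / d) * v ^ (-r) := by gcongr
        _ ≤ _ := le_mul_of_one_le_left (by positivity) h2
    split_ifs with hv1
    · have h1 : 1 ≤ v ^ (-r) :=
        Real.one_le_rpow_of_pos_of_le_one_of_nonpos hv hv1.le (by linarith)
      have h2 : 1 ≤ n * v ^ (-r) := by nlinarith
      nlinarith
    refine le_trans ?_ (min_one_le_rpow hy0.le hC hr hρ)
    have hgn := geomSum_nonneg (p - r * p * (1 - p / d)) (cutShell p v)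
    have hgle : geomSum (p - r * p * (1 - p / d)) (cutShell p v) ≤ g :=
      (geomSum_le_of_neg he _).trans (by rw [hg]; linarith)
    rw [hy]
    gcongr

end Rates

/-! ### Tails from the weak moment, and the degenerate law -/

section WeakMoment

variable {d : ℕ} {μ : Measure (EuclideanSpace ℝ (Fin d))} [IsProbabilityMeasure μ]

lemma measureReal_norm_gt_le {q : ℝ} (hq : 0 < q) (h : weakMoment q μ < ∞) {t : ℝ} (ht : 0 < t) :
    μ.real {y : EuclideanSpace ℝ (Fin d) | t < ‖y.ofLp‖} ≤ ((weakMoment q μ).toReal / t) ^ q := by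
  set N := (weakMoment q μ).toReal with hN
  have h1 : ENNReal.ofReal (t ^ q) * tail μ t ≤ ENNReal.ofReal (N ^ q) := by
    have h2 : ENNReal.ofReal (N ^ q) = weakMoment q μ ^ q := by
      rw [← ENNReal.ofReal_rpow_of_nonneg ENNReal.toReal_nonneg hq.le,
        ENNReal.ofReal_toReal h.ne]
    rw [h2, weakMoment, ← ENNReal.rpow_mul, one_div_mul_cancel hq.ne', ENNReal.rpow_one]
    exact le_iSup₂ (f := fun (t : ℝ) (_ : 0 < t) => ENNReal.ofReal (t ^ q) * tail μ t) t ht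
  rw [tail, ← ofReal_measureReal, ← ENNReal.ofReal_mul (by positivity),
    ENNReal.ofReal_le_ofReal_iff (by positivity)] at h1
  rw [Real.div_rpow ENNReal.toReal_nonneg ht.le, le_div_iff₀ (by positivity)]
  linarith

/-- All tails vanish, so the law is the point mass at 0. -/
lemma measure_ne_zero_of_weakMoment_eq_zero {q : ℝ} (hq : 0 < q) (h : weakMoment q μ = 0) :
    μ {y | y ≠ 0} = 0 := by
  have hsub : {y : EuclideanSpace ℝ (Fin d) | y ≠ 0}
      ⊆ ⋃ j : ℕ, {y | 1 / ((j : ℝ) + 1) < ‖y.ofLp‖} := by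
    intro y hy
    have hy0 : 0 < ‖y.ofLp‖ := by
      rw [norm_pos_iff]
      exact fun h0 => hy (WithLp.ofLp_injective 2 h0)
    obtain ⟨j, hj⟩ := exists_nat_one_div_lt hy0
    exact Set.mem_iUnion.2 ⟨j, hj⟩
  refine measure_mono_null hsub (measure_iUnion_null fun j => ?_)
  have h1 := measureReal_norm_gt_le (μ := μ) hq (by rw [h]; exact ENNReal.zero_lt_top)
    (by positivity : 0 < 1 / ((j : ℝ) + 1))
  rw [h, ENNReal.toReal_zero, zero_div, Real.zero_rpow hq.ne'] at h1
  rw [← ofReal_measureReal]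
  exact ENNReal.ofReal_of_nonpos h1

lemma wassersteinPow_empirical_zero {p : ℝ} (hp : 0 < p) (hμ : μ {y | y ≠ 0} = 0) {k : ℕ}
    (hk : 1 ≤ k) {y : Fin k → EuclideanSpace ℝ (Fin d)} (hy : ∀ i, y i = 0) :
    wassersteinPow p (empirical y) μ = 0 := by
  have := isProbabilityMeasure_empirical hk y
  have hmem : (empirical y).prod μ ∈ couplings (empirical y) μ := by
    refine ⟨inferInstance, ?_, ?_⟩
    · rw [Measure.map_fst_prod, measure_univ, one_smul]
    · rw [Measure.map_snd_prod, measure_univ, one_smul]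
  refine le_antisymm ((iInf₂_le _ hmem).trans (le_of_eq ?_)) zero_le
  have hm : Measurable fun z : EuclideanSpace ℝ (Fin d) × EuclideanSpace ℝ (Fin d) =>
      ENNReal.ofReal (‖z.1 - z.2‖ ^ p) :=
    ((measurable_fst.sub measurable_snd).norm.pow_const p).ennreal_ofReal
  rw [lintegral_prod _ hm.aemeasurable, empirical, lintegral_smul_measure,
    lintegral_finsetSum_measure, Finset.sum_eq_zero, smul_zero]
  intro i _
  rw [lintegral_dirac, hy i]
  have hae : ∀ᵐ x ∂μ, x = 0 := hμ
  refine (lintegral_congr_ae (g := fun _ => 0) ?_).trans lintegral_zero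
  filter_upwards [hae] with x hx
  simp [hx, Real.zero_rpow hp.ne']

end WeakMoment

/-! ### The deviation inequality -/

theorem theorem2p1 (d : ℕ) (hd : 1 ≤ d) (p : ℝ) (hp : 1 ≤ p) (r : ℝ) (hr : r ∈ Set.Ioo (1 : ℝ) 2) :
    ∃ C : ℝ, 0 < C ∧
      ∀ (Ω : Type*) [MeasurableSpace Ω] (P : Measure Ω) [IsProbabilityMeasure P]
        (μ : Measure (EuclideanSpace ℝ (Fin d))) [IsProbabilityMeasure μ]
        (n : ℕ) (X : Fin n → Ω → EuclideanSpace ℝ (Fin d)) (x : ℝ),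
        1 ≤ n → (p = d * (r - 1) / r → 2 ≤ n) → 0 < x →
        iIndepFun X P → (∀ i, HasLaw (X i) μ P) →
        weakMoment (r * p) μ < ∞ →
        P {ω | ENNReal.ofReal x < wassersteinPow p (empirical fun i => X i ω) μ}
            ≤ ENNReal.ofReal (C * deviationRate d p r (weakMoment (r * p) μ).toReal n x) ∧
        P {ω | ENNReal.ofReal (n * x) <
              ⨆ (k : ℕ) (hk : k ∈ Set.Icc 1 n),
                (k : ℝ≥0∞) * wassersteinPow p (empirical fun i : Fin k => X (i.castLE hk.2) ω) μ}
            ≤ ENNReal.ofReal (C * deviationRate d p r (weakMoment (r * p) μ).toReal n x) := by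
  obtain ⟨C, f, hC, hf, hfle⟩ := exists_deviationBound hd hp hr
  have hp0 : 0 < p := by linarith
  have hq : 0 < r * p := mul_pos (by linarith [hr.1]) hp0
  refine ⟨C, hC, ?_⟩
  intro Ω _ P _ μ _ n X x hn hn2 hx hind hlaw hfin
  have hn0 : (0 : ℝ) < n := by exact_mod_cast hn
  have hmax : P {ω | ENNReal.ofReal (n * x) < ⨆ (k : ℕ) (hk : k ∈ Set.Icc 1 n),
      (k : ℝ≥0∞) * wassersteinPow p (empirical fun i : Fin k => X (i.castLE hk.2) ω) μ}
      ≤ ENNReal.ofReal (C * deviationRate d p r (weakMoment (r * p) μ).toReal n x) := by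
    rcases (ENNReal.toReal_nonneg (a := weakMoment (r * p) μ)).eq_or_lt with h0 | h0
    -- If N = 0 there is no scale s, but almost surely all points are 0 and every cost vanishes, so
    -- the event is null.
    · have hw : weakMoment (r * p) μ = 0 :=
        ((ENNReal.toReal_eq_zero_iff _).1 h0.symm).resolve_right hfin.ne
      have hμ := measure_ne_zero_of_weakMoment_eq_zero hq hw
      have hsub : {ω | ENNReal.ofReal (n * x) < ⨆ (k : ℕ) (hk : k ∈ Set.Icc 1 n),
          (k : ℝ≥0∞) * wassersteinPow p (empirical fun i : Fin k => X (i.castLE hk.2) ω) μ}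
          ⊆ ⋃ i, X i ⁻¹' {y | y ≠ 0} := by
        intro ω hω
        by_contra hcon
        simp only [Set.mem_iUnion, Set.mem_preimage, Set.mem_ofPred_eq, not_exists, ne_eq,
          not_not] at hcon
        refine absurd (Set.mem_ofPred_eq ▸ hω) (not_lt.2 (le_trans (iSup₂_le fun k hk => ?_) zero_le))
        rw [wassersteinPow_empirical_zero hp0 hμ hk.1 fun i => hcon _, mul_zero]
      refine (measure_mono_null hsub (measure_iUnion_null fun i => ?_)).le.trans zero_le
      refine le_antisymm ((Measure.le_map_apply (hlaw i).aemeasurable _).trans ?_) zero_le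
      rw [(hlaw i).map_eq, hμ]
    · set N := (weakMoment (r * p) μ).toReal with hN
      rw [deviationRate_eq_scaledRate hd hp hr.1 h0 hn hx]
      -- Passing to the product space makes the variables measurable and fixes the universe.
      -- `Measure.le_map_apply` needs no measurability of the event.
      have hpi : P.map (fun ω i => X i ω) = Measure.pi fun _ : Fin n => μ := by
        rw [(iIndepFun_iff_map_fun_eq_pi_map fun i => (hlaw i).aemeasurable).1 hind]
        congr 1
        ext1 i
        exact (hlaw i).map_eq
      have hm : AEMeasurable (fun ω i => X i ω) P :=
        aemeasurable_pi_lambda _ fun i => (hlaw i).aemeasurable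
      refine (Measure.le_map_apply hm {y | ENNReal.ofReal (n * x) <
        ⨆ (k : ℕ) (hk : k ∈ Set.Icc 1 n),
          (k : ℝ≥0∞) * wassersteinPow p (empirical fun i : Fin k => y (i.castLE hk.2)) μ}).trans ?_
      rw [hpi]
      refine (hf _ (Measure.pi fun _ : Fin n => μ) μ n (fun i y => y i) N (n * x) hn h0
        (by positivity) (fun i => measurable_pi_apply i)
        (iIndepFun_pi (X := fun _ y => y) fun _ => aemeasurable_id)
        (fun i => (measurePreserving_eval (fun _ : Fin n => μ) i).map_eq)
        fun t ht => measureReal_norm_gt_le hq hfin ht).trans (ENNReal.ofReal_le_ofReal ?_)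
      exact hfle n hn hn2 _ (by positivity)
  -- The term k = n of the supremum yields the first bound.
  refine ⟨le_trans (measure_mono fun ω (hω : ENNReal.ofReal x < _) => ?_) hmax, hmax⟩
  have hnn : (n : ℝ≥0∞) ≠ 0 := by
    rw [Nat.cast_ne_zero]; omega
  have h1 : ENNReal.ofReal (n * x) < n * wassersteinPow p (empirical fun i => X i ω) μ := by
    rw [ENNReal.ofReal_mul hn0.le, ENNReal.ofReal_natCast]
    exact (ENNReal.mul_lt_mul_iff_right hnn (by simp)).2 hω
  change ENNReal.ofReal (n * x) < _
  exact h1.trans_le (le_iSup₂ (f := fun (k : ℕ) (hk : k ∈ Set.Icc 1 n) =>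
    (k : ℝ≥0∞) * wassersteinPow p (empirical fun i : Fin k => X (i.castLE hk.2) ω) μ) n
    ⟨hn, le_rfl⟩)
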